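/- Let $X=\mathbb R^d$, $N\ge 1$, $I=\{1,\dots,N\}$. For $i\in I$ let $\Phi_i:X\to\mathbb R$ be convex and continuously differentiable with $L$-Lipschitz gradient, and suppose that there are a global minimizer $\theta^i_*$ of $\Phi_i$ and a number $\lambda_i\in(0,1/4]$ with $$\tfrac12\langle x-\theta^i_*,\nabla\Phi_i(x)\rangle\ \ge\ \lambda_i\Big(\Phi_i(x)-\Phi_i(\theta^i_*)+\tfrac14\|x-\theta^i_*\|^2\Big)\qquad(x\in X).$$ Let $\gamma>0$ and let $(i(t))_{t\ge 0}$ be a càdlàg continuous-time Markov process on $I$ with uniform initial distribution and transition rate matrix $\mathbf\Gamma_N-N\gamma\,\mathbf I_N$, where all entries of the $N\times N$ matrix $\mathbf\Gamma_N$ are equal to $\gamma$ and $\mathbf I_N$ is the identity matrix. Let $0<m\le 1$, $\delta\in[0,1)$, and $q_0,p_0,\theta_0\in X$. Let $(q^m_t,p^m_t)_{t\ge 0}$ be the homogeneous stochastic gradient-momentum process with mass $m$, friction $1$ and learning rate $\nu=m^\delta$, $$dq^m_t=p^m_t\,dt,\qquad m\,dp^m_t=-\nabla\Phi_{i(t/m^\delta)}(q^m_t)\,dt-p^m_t\,dt,\qquad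 q^m_0=q_0,\ p^m_0=p_0,$$ and let $(\theta^m_t)_{t\ge 0}$ be the stochastic gradient process driven by the same index process, $$d\theta^m_t=-\nabla\Phi_{i(t/m^\delta)}(\theta^m_t)\,dt,\qquad \theta^m_0=\theta_0 .$$ Then for every $T>0$ $$\mathbb E\Big[\sup_{0\le t\le T}\|q^m_t-\theta^m_t\|\Big]\le \big(1+C'_Lm(1+T)\big)e^{m^{1-\delta}T(1+T)\gamma N}\big(\|q_0-\theta_0\|+m\|p_0\|\big)+\Big[e^{m^{1-\delta}T(1+T)\gamma N}-1+C'_Lm(T+1)\Big]K_{\Phi,T,\theta_0},$$ where $C'_L>0$ is a constant that depends only on $L$, and $K_{\Phi,T,\theta_0}>0$ is a constant that depends only on $\Phi=(\Phi_i)_{i\in I}$, $T$ and $\theta_0$. In particular (with $\delta,\gamma,T,p_0$ fixed) the right-hand side tends to $0$ as $m\downarrow 0$ if $q_0=\theta_0$. -/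

import Mathlib

open MeasureTheory Set Filter Topology
open scoped NNReal ENNReal

noncomputable section

/-- The parameter space `ℝ^d` with its Euclidean norm. -/
abbrev ParamSpace (d : ℕ) : Type := EuclideanSpace ℝ (Fin d)

/-- The transition rate matrix `Γ_N - N γ I_N`, where all entries of `Γ_N` equal `γ`. -/
def rateMatrix (N : ℕ) (γ : ℝ) : Matrix (Fin N) (Fin N) ℝ :=
  Matrix.of (fun _ _ => γ) - ((N : ℝ) * γ) • (1 : Matrix (Fin N) (Fin N) ℝ)

/-- `i` is an index process with parameter `γ`: a continuous-time Markov process on the `N` indices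
with càdlàg paths, uniform initial distribution and transition rate matrix `rateMatrix N γ`.
The Markov property with transition semigroup `t ↦ exp (t A)` is stated through the
finite-dimensional distributions. -/
structure IsIndexProcess {Ω : Type*} [MeasurableSpace Ω] (P : Measure Ω) {N : ℕ} (γ : ℝ)
    (i : ℝ → Ω → Fin N) : Prop where
  measurable : ∀ t, 0 ≤ t → Measurable (i t)
  cadlag : ∀ᵐ ω ∂P,
    (∀ t, 0 ≤ t → ContinuousWithinAt (fun s => i s ω) (Ici t) t) ∧
    (∀ t, 0 < t → ∃ j : Fin N, Tendsto (fun s => i s ω) (𝓝[<] t) (𝓝 j))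
  initial_uniform : ∀ j : Fin N, P.real {ω | i 0 ω = j} = 1 / (N : ℝ)
  markov : ∀ (n : ℕ) (t : Fin (n + 1) → ℝ) (x : Fin (n + 1) → Fin N), Monotone t → t 0 = 0 →
    P.real {ω | ∀ k, i (t k) ω = x k} =
      P.real {ω | i 0 ω = x 0} *
        ∏ k : Fin n, NormedSpace.exp ((t k.succ - t k.castSucc) • rateMatrix N γ)
          (x k.castSucc) (x k.succ)

/-- `(q, p)` is a homogeneous stochastic gradient-momentum process with friction `α`, mass `m` and
learning rate `ν`: continuous processes whose paths almost surely solve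
`dq = p dt`, `m dp = -∇Φ_{i(t/ν)}(q) dt - α p dt`, `q(0) = q₀`, `p(0) = p₀` (in integrated form,
because the right-hand side jumps with the index process). -/
structure IsHSGMP {Ω : Type*} [MeasurableSpace Ω] (P : Measure Ω) {d N : ℕ}
    (Φ : Fin N → ParamSpace d → ℝ) (i : ℝ → Ω → Fin N) (α m ν : ℝ) (q₀ p₀ : ParamSpace d)
    (q p : ℝ → Ω → ParamSpace d) : Prop where
  measurable_q : ∀ t, 0 ≤ t → Measurable (q t)
  measurable_p : ∀ t, 0 ≤ t → Measurable (p t)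
  path : ∀ᵐ ω ∂P,
    ContinuousOn (fun t => q t ω) (Ici 0) ∧ ContinuousOn (fun t => p t ω) (Ici 0) ∧
    ∀ t, 0 ≤ t →
      q t ω = q₀ + ∫ s in (0 : ℝ)..t, p s ω ∧
      m • p t ω = m • p₀ + ∫ s in (0 : ℝ)..t,
        (-gradient (Φ (i (s / ν) ω)) (q s ω) - α • p s ω)

/-- `θ` is a stochastic gradient process with learning rate `ν`: a continuous process whose paths
almost surely solve `dθ = -∇Φ_{i(t/ν)}(θ) dt`, `θ(0) = θ₀` (in integrated form). -/
structure IsSGP {Ω : Type*} [MeasurableSpace Ω] (P : Measure Ω) {d N : ℕ}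
    (Φ : Fin N → ParamSpace d → ℝ) (i : ℝ → Ω → Fin N) (ν : ℝ) (θ₀ : ParamSpace d)
    (θ : ℝ → Ω → ParamSpace d) : Prop where
  measurable_θ : ∀ t, 0 ≤ t → Measurable (θ t)
  path : ∀ᵐ ω ∂P,
    ContinuousOn (fun t => θ t ω) (Ici 0) ∧
    ∀ t, 0 ≤ t →
      θ t ω = θ₀ + ∫ s in (0 : ℝ)..t, -gradient (Φ (i (s / ν) ω)) (θ s ω)

/-- The dissipativity condition with friction `α`: there are a global minimizer `θs` of `f` and a
constant `lam ∈ (0, 1/4]` such that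
`(x - θs) · ∇f(x) / 2 ≥ lam (f(x) - f(θs) + α² ‖x - θs‖² / 4)` for all `x`. -/
def DissipativityCondition {d : ℕ} (α : ℝ) (f : ParamSpace d → ℝ) : Prop :=
  ∃ (θs : ParamSpace d) (lam : ℝ), (∀ x, f θs ≤ f x) ∧ 0 < lam ∧ lam ≤ 1 / 4 ∧
    ∀ x, lam * (f x - f θs + α ^ 2 * ‖x - θs‖ ^ 2 / 4) ≤ inner ℝ (x - θs) (gradient f x) / 2

/-- The error bound
`(1 + C m (1+T)) e^{m^{1-δ} T (1+T) γ N} (e_q + m e_p) + [e^{m^{1-δ} T (1+T) γ N} - 1 + C m (T+1)] K`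
where `e_q = ‖q₀ - θ₀‖` and `e_p = ‖p₀‖`. -/
def sgmpErrorBound (C K γ : ℝ) (N : ℕ) (δ T eq ep m : ℝ) : ℝ :=
  (1 + C * m * (1 + T)) * Real.exp (m ^ (1 - δ) * T * (1 + T) * γ * N) * (eq + m * ep)
    + (Real.exp (m ^ (1 - δ) * T * (1 + T) * γ * N) - 1 + C * m * (T + 1)) * K

end

/-! The proof splits according to whether `m * (1 + T)` lies below or above a threshold, `16 * L +
11`, depending only on `L`.

Below the threshold no probability is needed; the estimate holds on almost every path. The variable
`q + m • p` has derivative `-∇Φ(q)`, so it solves the descent equation up to the displacement `m •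
p`. Since all gradients are monotone, a change of index never drives it away from `θ`. A crude
energy estimate (`IsMomentumFlow.norm_sub_le_exp`) bounds `q - θ` by a constant multiple of the
data. Its prefactor is too large for the claim, but it bounds the gradients along `q` by some `G`.
Then `IsMomentumFlow.norm_sub_le_linear` splits the initial layer `exp (-t/m) • p₀` off the
momentum. The rest of `m • p` is at most `m * G`, and monotonicity gives coefficient exactly one on
the initial error plus a remainder `m * (1 + L * T) * G`.

Above the threshold the exponential in the claim dominates `exp ((κ - 1) N γ T / m^δ)` with `κ = 16
* L + 12`, a bound for the mean of `κ` to the number of index changes. This number controls the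
momentum dynamics: a shifted energy decreases while the index is frozen
(`IsMomentumFlow.momentumEnergy_antitone`) and grows by a factor at most `κ` at a change
(`momentumEnergy_switch`). Changes are counted along equidistant grids, where the Markov property
gives the exponential moment (`IsIndexProcess.lintegral_prod_le`), and Fatou's lemma handles the
refinement of the grid. -/

/-! ### Convex functions and their gradients -/

section Convex

variable {E : Type*} [NormedAddCommGroup E] [InnerProductSpace ℝ E] [CompleteSpace E]

theorem HasGradientAt.comp_hasDerivWithinAt {f : E → ℝ} {f' : E} {c : ℝ → E} {c' : E} {s : Set ℝ}
    {t : ℝ} (hf : HasGradientAt f f' (c t)) (hc : HasDerivWithinAt c c' s t) :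
    HasDerivWithinAt (fun u => f (c u)) (inner ℝ f' c') s t := by
  have h := hf.hasFDerivAt.comp_hasDerivWithinAt t hc
  rw [InnerProductSpace.toDual_apply_apply] at h
  exact h

/-- The first-order characterization of convexity. -/
theorem ConvexOn.inner_gradient_le_sub {f : E → ℝ} (hf : ConvexOn ℝ univ f) {f' x : E}
    (hd : HasGradientAt f f' x) (y : E) : inner ℝ f' (y - x) ≤ f y - f x := by
  have hc : ConvexOn ℝ univ (fun t : ℝ => f (x + t • (y - x))) := by
    have h := hf.comp_affineMap (AffineMap.lineMap x y : ℝ →ᵃ[ℝ] E)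
    rw [preimage_univ] at h
    refine h.congr fun t _ => ?_
    simp [AffineMap.lineMap_apply, add_comm]
  have hl : HasDerivAt (fun t : ℝ => x + t • (y - x)) (y - x) 0 := by
    simpa using ((hasDerivAt_id (0 : ℝ)).smul_const (y - x)).const_add x
  have hd0 : HasGradientAt f f' ((fun t : ℝ => x + t • (y - x)) 0) := by simpa using hd
  have hder := (hd0.comp_hasDerivWithinAt (s := univ) hl.hasDerivWithinAt).hasDerivAt univ_mem
  have := hc.le_slope_of_hasDerivAt (mem_univ 0) (mem_univ 1) one_pos hder
  simpa [slope_def_field] using this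

theorem ConvexOn.inner_gradient_sub_nonneg {f : E → ℝ} (hf : ConvexOn ℝ univ f)
    (hd : Differentiable ℝ f) (x y : E) :
    0 ≤ inner ℝ (x - y) (gradient f x - gradient f y) := by
  have h1 := hf.inner_gradient_le_sub (hd x).hasGradientAt y
  have h2 := hf.inner_gradient_le_sub (hd y).hasGradientAt x
  rw [← neg_sub x y, inner_neg_right, real_inner_comm] at h1
  rw [real_inner_comm] at h2
  rw [inner_sub_right]
  linarith

theorem gradient_eq_zero_of_forall_le {f : E → ℝ} {x : E} (h : ∀ y, f x ≤ f y) :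
    gradient f x = 0 := by
  have : IsLocalMin f x := Eventually.of_forall h
  simp [gradient, this.fderiv_eq_zero]

/-- The tangent at `q`, evaluated at `x`, and Cauchy–Schwarz suffice, because the gradient vanishes
at `x`. The sharp constant `L / 2` is not needed. -/
theorem ConvexOn.sub_le_of_lipschitz_gradient {f : E → ℝ} {L : ℝ≥0} (hf : ConvexOn ℝ univ f)
    (hd : Differentiable ℝ f) (hL : LipschitzWith L (gradient f)) {x : E} (h : ∀ y, f x ≤ f y)
    (q : E) : f q - f x ≤ L * ‖q - x‖ ^ 2 := by
  have h1 := hf.inner_gradient_le_sub (hd q).hasGradientAt x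
  have h2 := hL.norm_sub_le q x
  rw [gradient_eq_zero_of_forall_le h, sub_zero] at h2
  have h3 := real_inner_le_norm (gradient f q) (q - x)
  rw [← neg_sub q x, inner_neg_right] at h1
  have h4 := mul_le_mul_of_nonneg_right h2 (norm_nonneg (q - x))
  nlinarith

end Convex

/-! ### Right derivatives and comparison -/

section RightDerivative

variable {E : Type*} [NormedAddCommGroup E]

/-- A right-continuous function of a real variable is strongly measurable. -/
theorem stronglyMeasurable_of_rightContinuous {f : ℝ → E}
    (hf : ∀ t, ContinuousWithinAt f (Ici t) t) : StronglyMeasurable f := by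
  -- Sampling at the next grid point strictly to the right of `s`: the `+ 1` keeps the sample in
  -- `Ici s`, where right continuity applies.
  refine stronglyMeasurable_of_tendsto atTop
    (f := fun (n : ℕ) s => f (((⌊s * ((n : ℝ) + 1)⌋ : ℤ) + 1 : ℝ) / ((n : ℝ) + 1))) (fun n => ?_) ?_
  · have h1 : StronglyMeasurable (fun k : ℤ => f ((k + 1 : ℝ) / (n + 1))) := .of_discrete
    exact h1.comp_measurable (g := fun s : ℝ => ⌊s * ((n : ℝ) + 1)⌋)
      (Int.measurable_floor.comp (measurable_id.mul_const _))
  · rw [tendsto_pi_nhds]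
    intro s
    refine (hf s).tendsto.comp (tendsto_nhdsWithin_iff.2 ⟨?_, Eventually.of_forall fun n => ?_⟩)
    · have h0 : Tendsto (fun n : ℕ => s + 1 / ((n : ℝ) + 1)) atTop (𝓝 (s + 0)) :=
        tendsto_const_nhds.add tendsto_one_div_add_atTop_nhds_zero_nat
      rw [add_zero] at h0
      refine tendsto_of_tendsto_of_tendsto_of_le_of_le tendsto_const_nhds h0 (fun n => ?_)
        fun n => ?_
      · have hn : (0 : ℝ) < n + 1 := by positivity
        rw [le_div_iff₀ hn]
        exact (Int.lt_floor_add_one _).le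
      · have hn : (0 : ℝ) < n + 1 := by positivity
        simp only
        rw [div_le_iff₀ hn, add_mul, one_div, inv_mul_cancel₀ hn.ne']
        linarith [Int.floor_le (s * ((n : ℝ) + 1))]
    · have hn : (0 : ℝ) < n + 1 := by positivity
      rw [mem_Ici, le_div_iff₀ hn]
      exact (Int.lt_floor_add_one _).le

theorem aestronglyMeasurable_of_rightContinuous {f : ℝ → E}
    (hf : ∀ t, 0 ≤ t → ContinuousWithinAt f (Ici t) t) :
    AEStronglyMeasurable f (volume.restrict (Ici 0)) := by
  have h : StronglyMeasurable (fun s => f (max s 0)) := by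
    refine stronglyMeasurable_of_rightContinuous fun t => ?_
    have h1 := hf (max t 0) (le_max_right _ _)
    refine ContinuousWithinAt.comp (f := fun s : ℝ => max s 0) h1 (by fun_prop) fun s hs => ?_
    exact max_le_max_right 0 (mem_Ici.1 hs)
  refine ⟨_, h, ?_⟩
  filter_upwards [self_mem_ae_restrict measurableSet_Ici] with s hs
  rw [max_eq_left hs]

/-- The fundamental theorem of calculus for right derivatives of integrals of right-continuous
functions. -/
theorem hasDerivWithinAt_integral_of_rightContinuous [NormedSpace ℝ E] [CompleteSpace E]
    {f : ℝ → E} {b : ℝ → ℝ} (hf : ∀ t, 0 ≤ t → ContinuousWithinAt f (Ici t) t)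
    (hb : ContinuousOn b (Ici 0)) (hfb : ∀ t, 0 ≤ t → ‖f t‖ ≤ b t) {t : ℝ} (ht : 0 ≤ t) :
    HasDerivWithinAt (fun u => ∫ s in (0 : ℝ)..u, f s) (f t) (Ici t) t := by
  have hm := aestronglyMeasurable_of_rightContinuous hf
  have hint : IntervalIntegrable f volume 0 t := by
    have hbi : IntervalIntegrable b volume 0 t :=
      (hb.mono (by rw [uIcc_of_le ht]; exact Icc_subset_Ici_self)).intervalIntegrable
    refine hbi.mono_fun' (hm.mono_measure (Measure.restrict_mono ?_ le_rfl)) ?_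
    · rw [uIoc_of_le ht]; exact fun s hs => hs.1.le
    · filter_upwards [self_mem_ae_restrict measurableSet_uIoc] with s hs
      rw [uIoc_of_le ht] at hs
      exact hfb s hs.1.le
  refine intervalIntegral.integral_hasDerivWithinAt_right hint (t := Ioi t) ?_
    ((hf t ht).mono Ioi_subset_Ici_self)
  exact ⟨Ioi t, self_mem_nhdsWithin,
    hm.mono_measure (Measure.restrict_mono (fun s hs => ht.trans (le_of_lt hs)) le_rfl)⟩

/-- A bound on the norm from a bound on the radial part of the right derivative. -/
theorem norm_le_of_inner_deriv_right_le [InnerProductSpace ℝ E] {w w' : ℝ → E} {B B' : ℝ → ℝ}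
    {a b : ℝ} (hw : ContinuousOn w (Icc a b))
    (hw' : ∀ x ∈ Ico a b, HasDerivWithinAt w (w' x) (Ici x) x) (ha : ‖w a‖ ≤ B a)
    (hB : ∀ x, HasDerivAt B (B' x) x) (hB0 : ∀ x, 0 ≤ B' x)
    (bound : ∀ x ∈ Ico a b, inner ℝ (w x) (w' x) ≤ ‖w x‖ * B' x) {x : ℝ} (hx : x ∈ Icc a b) :
    ‖w x‖ ≤ B x := by
  -- The norm is not differentiable at zero, so it is smoothed to `√(‖w‖² + ε²)`.
  refine le_of_forall_pos_le_add fun ε hε => ?_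
  have hpos : ∀ y, 0 < ‖w y‖ ^ 2 + ε ^ 2 := fun y => by positivity
  have key : √(‖w x‖ ^ 2 + ε ^ 2) ≤ B x + ε := by
    refine image_le_of_deriv_right_le_deriv_boundary (f := fun y => √(‖w y‖ ^ 2 + ε ^ 2))
      (f' := fun y => (2 * inner ℝ (w y) (w' y)) / (2 * √(‖w y‖ ^ 2 + ε ^ 2)))
      (B := fun y => B y + ε) (B' := B') ?_ ?_ ?_ ?_ ?_ ?_ hx
    · exact ((hw.norm.pow 2).add continuousOn_const).sqrt
    · exact fun y hy => ((hw' y hy).norm_sq.add_const _).sqrt (hpos y).ne'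
    · refine Real.sqrt_le_iff.2 ⟨by linarith [norm_nonneg (w a)], ?_⟩
      nlinarith [norm_nonneg (w a)]
    · exact fun y _ => ((hB y).continuousAt.add continuousAt_const).continuousWithinAt
    · exact fun y _ => ((hB y).add_const _).hasDerivWithinAt
    · intro y hy
      have hs := Real.sqrt_pos.2 (hpos y)
      rw [div_le_iff₀ (by positivity)]
      have h1 : ‖w y‖ ≤ √(‖w y‖ ^ 2 + ε ^ 2) := Real.le_sqrt_of_sq_le (by nlinarith)
      nlinarith [bound y hy, mul_le_mul_of_nonneg_right h1 (hB0 y)]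
  exact (Real.le_sqrt_of_sq_le (by nlinarith)).trans key

end RightDerivative

/-! ### Pathwise comparison of momentum and descent flows -/

section Deterministic

variable {E : Type*} [NormedAddCommGroup E] [InnerProductSpace ℝ E]

/-- `(q, p)` solves `q' = p`, `m p' = -A_t(q) - p` on `[0, T]` in the sense of right derivatives. -/
structure IsMomentumFlow (A : ℝ → E → E) (m T : ℝ) (q p : ℝ → E) : Prop where
  continuousOn_q : ContinuousOn q (Icc 0 T)
  continuousOn_p : ContinuousOn p (Icc 0 T)
  deriv_q : ∀ t ∈ Ico 0 T, HasDerivWithinAt q (p t) (Ici t) t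
  deriv_p : ∀ t ∈ Ico 0 T, HasDerivWithinAt (fun s => m • p s) (-A t (q t) - p t) (Ici t) t

/-- `θ` solves `θ' = -A_t(θ)` on `[0, T]` in the sense of right derivatives. -/
structure IsDescentFlow (A : ℝ → E → E) (T : ℝ) (θ : ℝ → E) : Prop where
  continuousOn : ContinuousOn θ (Icc 0 T)
  deriv : ∀ t ∈ Ico 0 T, HasDerivWithinAt θ (-A t (θ t)) (Ici t) t

variable {A : ℝ → E → E} {m T : ℝ} {q p θ : ℝ → E} {L : ℝ≥0}

theorem le_mul_exp_of_deriv_right_le {f f' : ℝ → ℝ} {c a b : ℝ} (hf : ContinuousOn f (Icc a b))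
    (hf' : ∀ x ∈ Ico a b, HasDerivWithinAt f (f' x) (Ici x) x)
    (bound : ∀ x ∈ Ico a b, f' x ≤ c * f x) {x : ℝ} (hx : x ∈ Icc a b) :
    f x ≤ f a * Real.exp (c * (x - a)) := by
  rw [← gronwallBound_ε0]
  refine le_gronwallBound_of_liminf_deriv_right_le hf
    (fun y hy r hr => (hf' y hy).liminf_right_slope_le hr) le_rfl ?_ x hx
  simpa using bound

theorem IsDescentFlow.norm_sub_le (hθ : IsDescentFlow A T θ)
    (hA : ∀ t, LipschitzWith L (A t)) {G : ℝ} (hG0 : 0 ≤ G)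
    (hG : ∀ t ∈ Ico 0 T, ‖A t (θ 0)‖ ≤ G) {t : ℝ} (ht : t ∈ Icc 0 T) :
    ‖θ t - θ 0‖ ≤ gronwallBound 0 L G T := by
  have h := norm_le_gronwallBound_of_norm_deriv_right_le (f := fun s => θ s - θ 0)
    (f' := fun s => -A s (θ s)) (δ := 0) (K := L) (ε := G) (a := 0) (b := T)
    (hθ.continuousOn.sub continuousOn_const) (fun s hs => (hθ.deriv s hs).sub_const _) (by simp)
    (fun s hs => ?_) t ht
  · refine h.trans (gronwallBound_mono le_rfl hG0 L.2 ?_)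
    linarith [ht.2]
  · rw [norm_neg]
    have h1 := norm_le_norm_add_norm_sub' (A s (θ s)) (A s (θ 0))
    linarith [(hA s).norm_sub_le (θ s) (θ 0), hG s hs]

theorem IsMomentumFlow.hasDerivWithinAt_add (h : IsMomentumFlow A m T q p) {t : ℝ}
    (ht : t ∈ Ico 0 T) :
    HasDerivWithinAt (fun s => q s + m • p s) (-A t (q t)) (Ici t) t := by
  refine ((h.deriv_q t ht).add (h.deriv_p t ht)).congr_deriv ?_
  abel

/-- A momentum flow and a descent flow driven by the same monotone Lipschitz vector fields separate
at most exponentially in `m * T`. -/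
theorem IsMomentumFlow.norm_sub_le_exp (h : IsMomentumFlow A m T q p) (hθ : IsDescentFlow A T θ)
    (hm : 0 < m) (hA : ∀ t, LipschitzWith L (A t))
    (hmono : ∀ t x y, 0 ≤ inner ℝ (x - y) (A t x - A t y)) {K : ℝ} (hK0 : 0 ≤ K)
    (hK : ∀ t ∈ Ico 0 T, ‖A t (θ t)‖ ≤ K) {t : ℝ} (ht : t ∈ Icc 0 T) :
    ‖q t - θ t‖ ≤
      2 * Real.exp (4 * (L ^ 2 + 1) * (m * T)) * (‖q 0 - θ 0‖ + m * ‖p 0‖ + K) := by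
  set w : ℝ → E := fun s => q s + m • p s - θ s with hw
  -- Adding the constant `K ^ 2` makes the differential inequality homogeneous. Every surviving term
  -- of the derivative carries a factor `m`, hence a rate proportional to `m`.
  have hgr : ‖w t‖ ^ 2 + ‖m • p t‖ ^ 2 + K ^ 2 ≤
      (‖w 0‖ ^ 2 + ‖m • p 0‖ ^ 2 + K ^ 2) * Real.exp (8 * m * (L ^ 2 + 1) * (t - 0)) := by
    refine le_mul_exp_of_deriv_right_le (f := fun s => ‖w s‖ ^ 2 + ‖m • p s‖ ^ 2 + K ^ 2)
      (f' := fun s => 2 * inner ℝ (w s) (-A s (q s) - -A s (θ s)) +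
        2 * inner ℝ (m • p s) (-A s (q s) - p s)) ?_ (fun s hs => ?_) (fun s hs => ?_) ht
    · have h1 := h.continuousOn_q
      have h2 := h.continuousOn_p
      have h3 := hθ.continuousOn
      fun_prop
    · exact ((((h.hasDerivWithinAt_add hs).sub (hθ.deriv s hs)).norm_sq).add
        (h.deriv_p s hs).norm_sq).add_const _
    -- Inserting `A (q + m • p)` yields a monotone term of good sign and an error that is Lipschitz
    -- in `m • p`.
    · have e1 : inner ℝ (w s) (-A s (q s) - -A s (θ s)) =
          -inner ℝ (q s + m • p s - θ s) (A s (q s + m • p s) - A s (θ s)) +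
          inner ℝ (w s) (A s (q s + m • p s) - A s (q s)) := by
        rw [← inner_neg_right, ← inner_add_right]
        congr 1
        abel
      have e2 := hmono s (q s + m • p s) (θ s)
      have e3 := real_inner_le_norm (w s) (A s (q s + m • p s) - A s (q s))
      have e4 := (hA s).norm_sub_le (q s + m • p s) (q s)
      rw [add_sub_cancel_left, norm_smul, Real.norm_of_nonneg hm.le] at e4
      have e5 : inner ℝ (m • p s) (-A s (q s) - p s) =
          m * (-inner ℝ (p s) (A s (q s)) - ‖p s‖ ^ 2) := by
        rw [real_inner_smul_left, inner_sub_right, inner_neg_right, real_inner_self_eq_norm_sq]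
      have e6 := neg_le_of_abs_le (abs_real_inner_le_norm (p s) (A s (q s)))
      have e7 : ‖A s (q s)‖ ≤ L * (‖w s‖ + m * ‖p s‖) + K := by
        have f1 := norm_le_norm_add_norm_sub' (A s (q s)) (A s (θ s))
        have f2 := (hA s).norm_sub_le (q s) (θ s)
        have f3 : ‖q s - θ s‖ ≤ ‖w s‖ + m * ‖p s‖ := by
          have : q s - θ s = w s - m • p s := by simp only [hw]; abel
          rw [this]
          refine (norm_sub_le _ _).trans_eq ?_
          rw [norm_smul, Real.norm_of_nonneg hm.le]
        have f4 := mul_le_mul_of_nonneg_left f3 L.2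
        have f5 := hK s hs
        change (L : ℝ) * _ ≤ (L : ℝ) * _ at f4
        linarith
      rw [e1, e5, norm_smul, Real.norm_of_nonneg hm.le]
      have e8 : inner ℝ (w s) (A s (q s + m • p s) - A s (q s)) ≤
          ‖w s‖ * (L * (m * ‖p s‖)) :=
        e3.trans (mul_le_mul_of_nonneg_left e4 (norm_nonneg _))
      have hw0 := norm_nonneg (w s)
      have hp0 := norm_nonneg (p s)
      have hg0 := norm_nonneg (A s (q s))
      have hL0 : (0 : ℝ) ≤ L := L.2
      generalize ‖w s‖ = a at *
      generalize ‖p s‖ = b at *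
      generalize ‖A s (q s)‖ = g at *
      generalize (L : ℝ) = l at *
      -- The friction term `-2 * b ^ 2` absorbs both products containing the unscaled momentum `b`.
      have e9 : 2 * (a * (l * b)) + 2 * (b * g) - 2 * b ^ 2 ≤ 2 * (l * a) ^ 2 + 2 * g ^ 2 := by
        nlinarith [sq_nonneg (2 * (l * a) - b), sq_nonneg (2 * g - b)]
      have e10 : g ^ 2 ≤ 3 * ((l * a) ^ 2 + (l * (m * b)) ^ 2 + K ^ 2) := by
        have : g ^ 2 ≤ (l * a + l * (m * b) + K) ^ 2 := pow_le_pow_left₀ hg0 (by linarith) 2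
        nlinarith [sq_nonneg (l * a - l * (m * b)), sq_nonneg (l * a - K),
          sq_nonneg (l * (m * b) - K)]
      have e11 : 2 * (l * a) ^ 2 + 2 * g ^ 2 ≤
          8 * (l ^ 2 + 1) * (a ^ 2 + (m * b) ^ 2 + K ^ 2) := by
        nlinarith [mul_nonneg (sq_nonneg l) (sq_nonneg K), sq_nonneg a, sq_nonneg (m * b),
          sq_nonneg K, mul_nonneg (sq_nonneg l) (sq_nonneg (m * b))]
      have e12 := mul_le_mul_of_nonneg_left (e9.trans e11) hm.le
      have e13 := mul_le_mul_of_nonneg_left e6 hm.le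
      nlinarith
  have hpn : ‖m • p 0‖ = m * ‖p 0‖ := by rw [norm_smul, Real.norm_of_nonneg hm.le]
  have hw0 : ‖w 0‖ ≤ ‖q 0 - θ 0‖ + m * ‖p 0‖ := by
    have : w 0 = (q 0 - θ 0) + m • p 0 := by simp only [hw]; abel
    rw [this, ← hpn]
    exact norm_add_le _ _
  have hexp : Real.exp (8 * m * (L ^ 2 + 1) * (t - 0)) ≤
      Real.exp (4 * (L ^ 2 + 1) * (m * T)) ^ 2 := by
    rw [← Real.exp_nat_mul]
    refine Real.exp_le_exp.2 ?_
    have := mul_le_mul_of_nonneg_left ht.2 (show 0 ≤ 8 * m * ((L : ℝ) ^ 2 + 1) by positivity)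
    push_cast
    linarith
  have hqw : ‖q t - θ t‖ ≤ ‖w t‖ + ‖m • p t‖ := by
    have : q t - θ t = w t - m • p t := by simp only [hw]; abel
    rw [this]
    exact norm_sub_le _ _
  have hS0 : 0 ≤ ‖q 0 - θ 0‖ + m * ‖p 0‖ := by positivity
  have hE0 := (Real.exp_pos (4 * ((L : ℝ) ^ 2 + 1) * (m * T))).le
  have hq0 := norm_nonneg (q 0 - θ 0)
  have hmp0 : 0 ≤ m * ‖p 0‖ := by positivity
  rw [hpn] at hgr
  refine abs_le_of_sq_le_sq' ?_ (by positivity) |>.2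
  have g1 : ‖q t - θ t‖ ^ 2 ≤ 2 * (‖w t‖ ^ 2 + ‖m • p t‖ ^ 2) := by
    have := pow_le_pow_left₀ (norm_nonneg _) hqw 2
    nlinarith [sq_nonneg (‖w t‖ - ‖m • p t‖)]
  have g2 : ‖w 0‖ ^ 2 + (m * ‖p 0‖) ^ 2 + K ^ 2 ≤
      2 * (‖q 0 - θ 0‖ + m * ‖p 0‖ + K) ^ 2 := by
    have := pow_le_pow_left₀ (norm_nonneg _) hw0 2
    nlinarith [mul_nonneg hq0 hmp0, mul_nonneg hS0 hK0, sq_nonneg K,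
      sq_nonneg ‖q 0 - θ 0‖]
  have g3 := hgr.trans (mul_le_mul g2 hexp (Real.exp_pos _).le (by positivity))
  nlinarith [sq_nonneg K]

/-- A momentum flow stays close to a descent flow, with the sharp dependence on the initial
values. -/
theorem IsMomentumFlow.norm_sub_le_linear (h : IsMomentumFlow A m T q p)
    (hθ : IsDescentFlow A T θ) (hm : 0 < m) (hA : ∀ t, LipschitzWith L (A t))
    (hmono : ∀ t x y, 0 ≤ inner ℝ (x - y) (A t x - A t y)) {G : ℝ} (hG0 : 0 ≤ G)
    (hG : ∀ t ∈ Ico 0 T, ‖A t (q t)‖ ≤ G) {t : ℝ} (ht : t ∈ Icc 0 T) :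
    ‖q t - θ t‖ ≤ ‖q 0 - θ 0‖ + m * ‖p 0‖ + m * (1 + L * T) * G := by
  have hL0 : (0 : ℝ) ≤ L := L.2
  have hexp : ∀ (c : ℝ) s, HasDerivAt (fun u => Real.exp (c * u)) (c * Real.exp (c * s)) s := by
    intro c s
    have := ((hasDerivAt_id s).const_mul c).exp
    simpa [mul_comm] using this
  -- Subtracting the force-free decay of the initial momentum leaves a remainder that starts at zero
  -- and is driven by the gradient alone.
  set r : ℝ → E := fun s => m • p s - (m * Real.exp (-m⁻¹ * s)) • p 0 with hr
  have hr' : ∀ s ∈ Ico 0 T, HasDerivWithinAt r (-A s (q s) - m⁻¹ • r s) (Ici s) s := by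
    intro s hs
    have h1 := (h.deriv_p s hs).sub
      ((((hexp (-m⁻¹) s).const_mul m).smul_const (p 0)).hasDerivWithinAt (s := Ici s))
    refine h1.congr_deriv ?_
    simp only [hr, smul_sub, smul_smul, inv_mul_cancel₀ hm.ne', one_smul]
    have : m * (-m⁻¹ * Real.exp (-m⁻¹ * s)) = -Real.exp (-m⁻¹ * s) := by field_simp
    rw [this, ← mul_assoc, inv_mul_cancel₀ hm.ne', one_mul, neg_smul]
    abel
  have hrc : ContinuousOn r (Icc 0 T) := by
    have := h.continuousOn_p
    fun_prop
  have hr0 : r 0 = 0 := by simp [hr]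
  have hrb : ∀ s ∈ Icc 0 T, ‖r s‖ ≤ m * G := by
    intro s hs
    -- Integrating factor `exp (t / m)`: relaxation at rate `1 / m` turns a force of size `G` into a
    -- remainder of size `m * G`.
    have h1 := image_norm_le_of_norm_deriv_right_le_deriv_boundary
      (f := fun u => Real.exp (m⁻¹ * u) • r u)
      (f' := fun u => Real.exp (m⁻¹ * u) • (-A u (q u)))
      (B := fun u => m * G * Real.exp (m⁻¹ * u)) (B' := fun u => G * Real.exp (m⁻¹ * u))
      (a := 0) (b := T) (by fun_prop) (fun u hu => ?_) (by simp [hr0]; positivity) (fun u => ?_)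
      (fun u hu => ?_) hs
    · rw [norm_smul, Real.norm_of_nonneg (Real.exp_pos _).le, mul_comm] at h1
      exact le_of_mul_le_mul_right h1 (Real.exp_pos _)
    · refine ((hexp m⁻¹ u).hasDerivWithinAt.smul (hr' u hu)).congr_deriv ?_
      module
    · refine ((hexp m⁻¹ u).const_mul (m * G)).congr_deriv ?_
      field_simp
    · rw [norm_smul, norm_neg, Real.norm_of_nonneg (Real.exp_pos _).le, mul_comm]
      exact mul_le_mul_of_nonneg_right (hG u hu) (Real.exp_pos _).le
  set w : ℝ → E := fun s => q s + r s - θ s with hw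
  have hwb : ‖w t‖ ≤ ‖q 0 - θ 0‖ + m * ‖p 0‖ * (1 - Real.exp (-m⁻¹ * t)) +
      L * (m * G) * t := by
    refine norm_le_of_inner_deriv_right_le (w := w)
      (w' := fun s => p s + (-A s (q s) - m⁻¹ • r s) - -A s (θ s))
      (B := fun s => ‖q 0 - θ 0‖ + m * ‖p 0‖ * (1 - Real.exp (-m⁻¹ * s)) + L * (m * G) * s)
      (B' := fun s => ‖p 0‖ * Real.exp (-m⁻¹ * s) + L * (m * G)) ?_ (fun s hs => ?_) ?_
      (fun s => ?_) (fun s => by positivity) (fun s hs => ?_) ht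
    · have h1 := h.continuousOn_q
      have h3 := hθ.continuousOn
      fun_prop
    · exact ((h.deriv_q s hs).add (hr' s hs)).sub (hθ.deriv s hs)
    · simp [hw, hr0]
    · refine ((((hexp (-m⁻¹) s).const_sub 1).const_mul (m * ‖p 0‖)).const_add _ |>.add
        ((hasDerivAt_id s).const_mul (L * (m * G)))).congr_deriv ?_
      field_simp
    -- The layer contributes the integral of `exp (-s / m) * ‖p 0‖`, at most `m * ‖p 0‖`; the middle
    -- difference is monotone and the last one is at most `L * (m * G)`.
    · have e0 : p s + (-A s (q s) - m⁻¹ • r s) - -A s (θ s) = Real.exp (-m⁻¹ * s) • p 0 -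
          (A s (q s + r s) - A s (θ s)) + (A s (q s + r s) - A s (q s)) := by
        simp only [hr, smul_sub, smul_smul, inv_mul_cancel₀ hm.ne', one_smul]
        rw [← mul_assoc, inv_mul_cancel₀ hm.ne', one_mul]
        abel
      have e1 := real_inner_le_norm (w s) (Real.exp (-m⁻¹ * s) • p 0)
      rw [norm_smul, Real.norm_of_nonneg (Real.exp_pos _).le] at e1
      have e2 := hmono s (q s + r s) (θ s)
      have e3 := real_inner_le_norm (w s) (A s (q s + r s) - A s (q s))
      have e4 := (hA s).norm_sub_le (q s + r s) (q s)
      rw [add_sub_cancel_left] at e4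
      have e5 := e4.trans (mul_le_mul_of_nonneg_left (hrb s (Ico_subset_Icc_self hs)) hL0)
      have e6 := mul_le_mul_of_nonneg_left e5 (norm_nonneg (w s))
      rw [e0, inner_add_right, inner_sub_right]
      have e7 : inner ℝ (w s) (A s (q s + r s) - A s (θ s)) =
        inner ℝ (q s + r s - θ s) (A s (q s + r s) - A s (θ s)) := rfl
      linarith
  have hqw : ‖q t - θ t‖ ≤ ‖w t‖ + ‖r t‖ := by
    have : q t - θ t = w t - r t := by simp only [hw]; abel
    rw [this]
    exact norm_sub_le _ _
  have g1 := hrb t ht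
  have g2 : L * (m * G) * t ≤ L * (m * G) * T := mul_le_mul_of_nonneg_left ht.2 (by positivity)
  have g3 : 0 ≤ m * ‖p 0‖ * Real.exp (-m⁻¹ * t) := by positivity
  linarith

end Deterministic

/-! ### Exponential moments of the number of index changes -/

section MarkovChain

/-- The exponential of a multiple of an idempotent. -/
theorem Matrix.exp_smul_of_isIdempotentElem {n : Type*} [Fintype n] [DecidableEq n]
    {M : Matrix n n ℝ} (hM : IsIdempotentElem M) (c : ℝ) :
    NormedSpace.exp (c • M) = Real.exp c • M + (1 - M) := by
  let : NormedRing (Matrix n n ℝ) := Matrix.linftyOpNormedRing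
  let : NormedAlgebra ℝ (Matrix n n ℝ) := Matrix.linftyOpNormedAlgebra
  have h1 := NormedSpace.exp_series_hasSum_exp' (𝕂 := ℝ) (c • M)
  have h2 : HasSum (fun k : ℕ => ((k.factorial : ℝ)⁻¹ * c ^ k) • M + if k = 0 then 1 - M else 0)
      (Real.exp c • M + (1 - M)) := by
    refine HasSum.add ?_ (hasSum_ite_eq 0 (1 - M))
    have h3 := NormedSpace.exp_series_hasSum_exp' (𝕂 := ℝ) c
    rw [← Real.exp_eq_exp_ℝ] at h3
    exact h3.smul_const M
  refine h1.unique (h2.congr_fun ?_)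
  intro k
  rcases Nat.eq_zero_or_pos k with rfl | hk
  · simp
  · rw [smul_pow, hM.pow_eq hk.ne', smul_smul, if_neg hk.ne', add_zero]

/-- The generator is `-N γ` times the projection `1 - J`, where `J` averages over all indices. -/
theorem exp_smul_rateMatrix {N : ℕ} (hN : 1 ≤ N) (γ h : ℝ) (a b : Fin N) :
    NormedSpace.exp (h • rateMatrix N γ) a b =
      (if a = b then Real.exp (-(N * γ * h)) else 0) + (1 - Real.exp (-(N * γ * h))) / N := by
  have hN0 : (N : ℝ) ≠ 0 := by positivity
  set M : Matrix (Fin N) (Fin N) ℝ := 1 - Matrix.of fun _ _ => (N : ℝ)⁻¹ with hMdef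
  have hJ : IsIdempotentElem (Matrix.of fun _ _ : Fin N => (N : ℝ)⁻¹) := by
    ext a b
    simp [Matrix.mul_apply, hN0]
  have hM : IsIdempotentElem M := hJ.one_sub
  have hr : h • rateMatrix N γ = (-(N * γ * h)) • M := by
    ext a b
    by_cases hab : a = b
    · simp [rateMatrix, hMdef, hab]; field_simp; ring
    · simp [rateMatrix, hMdef, hab]; field_simp
  rw [hr, Matrix.exp_smul_of_isIdempotentElem hM]
  by_cases hab : a = b
  · simp [hMdef, hab]; field_simp; ring
  · simp [hMdef, hab]; field_simp; ring

/-- The sum over all paths of a product of weights along the path, for constant row sums. -/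
theorem sum_prod_path {α : Type*} [Fintype α] [DecidableEq α] (Q : α → α → ℝ) (r : ℝ)
    (hQ : ∀ a, ∑ b, Q a b = r) (n : ℕ) :
    ∑ x : Fin (n + 1) → α, ∏ k : Fin n, Q (x k.castSucc) (x k.succ) =
      Fintype.card α * r ^ n := by
  induction n with
  | zero => simp
  | succ n ih =>
    rw [← (Fin.snocEquiv fun _ => α).sum_comp, Fintype.sum_prod_type, Finset.sum_comm]
    have h : ∀ (x : Fin (n + 1) → α), ∑ a : α, ∏ k : Fin (n + 1),
        Q (Fin.snocEquiv (fun _ => α) (a, x) k.castSucc)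
          (Fin.snocEquiv (fun _ => α) (a, x) k.succ) =
        (∏ k : Fin n, Q (x k.castSucc) (x k.succ)) * r := by
      intro x
      rw [← hQ (x (Fin.last n)), Finset.mul_sum]
      refine Finset.sum_congr rfl fun a _ => ?_
      rw [Fin.prod_univ_castSucc]
      simp only [Fin.snocEquiv_apply, Fin.snoc_castSucc, Fin.succ_last, Fin.snoc_last,
        ← Fin.castSucc_succ]
    have h' := Finset.sum_congr (rfl : (Finset.univ : Finset (Fin (n + 1) → α)) = Finset.univ)
      fun x _ => h x
    refine h'.trans ?_
    rw [← Finset.sum_mul, ih, pow_succ, mul_assoc]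

/-- The value does not depend on `a`, so the weights multiply along a path. The factor after `κ - 1`
is the probability of a change over time `h`. -/
theorem sum_exp_smul_rateMatrix_mul {N : ℕ} (hN : 1 ≤ N) (γ h κ : ℝ) (a : Fin N) :
    ∑ b, NormedSpace.exp (h • rateMatrix N γ) a b * (if a = b then 1 else κ) =
      1 + (κ - 1) * ((1 - Real.exp (-(N * γ * h))) * (N - 1) / N) := by
  have hN0 : (N : ℝ) ≠ 0 := by positivity
  have : ∀ b, NormedSpace.exp (h • rateMatrix N γ) a b * (if a = b then 1 else κ) =
      (if a = b then Real.exp (-(N * γ * h)) + (1 - κ) * (1 - Real.exp (-(N * γ * h))) / N else 0)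
        + κ * (1 - Real.exp (-(N * γ * h))) / N := by
    intro b
    rw [exp_smul_rateMatrix hN]
    split_ifs <;> ring
  simp only [this, Finset.sum_add_distrib, Finset.sum_ite_eq, Finset.mem_univ, if_true,
    Finset.sum_const, Finset.card_univ, Fintype.card_fin, nsmul_eq_mul]
  field_simp
  ring

/-- The exponential moment of the number of changes along an equidistant grid. -/
theorem IsIndexProcess.lintegral_prod_le {Ω : Type*} [MeasurableSpace Ω] {P : Measure Ω}
    [IsProbabilityMeasure P] {N : ℕ} (hN : 1 ≤ N) {γ : ℝ} (hγ : 0 < γ) {i : ℝ → Ω → Fin N}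
    (hi : IsIndexProcess P γ i) {κ : ℝ} (hκ : 1 ≤ κ) {h : ℝ} (hh : 0 ≤ h) (n : ℕ) :
    ∫⁻ ω, ENNReal.ofReal (∏ k : Fin n,
        if i (k * h) ω = i ((k + 1 : ℕ) * h) ω then 1 else κ) ∂P ≤
      ENNReal.ofReal (Real.exp ((κ - 1) * N * γ * (n * h))) := by
  have hN0 : (0 : ℝ) < N := by positivity
  set X : Ω → Fin (n + 1) → Fin N := fun ω k => i (k * h) ω with hX
  have hXm : Measurable X := measurable_pi_lambda _ fun k => hi.measurable _ (by positivity)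
  set F : (Fin (n + 1) → Fin N) → ℝ := fun x => ∏ k : Fin n,
    if x k.castSucc = x k.succ then 1 else κ with hF
  have hF0 : ∀ x, 0 ≤ F x := fun x => Finset.prod_nonneg fun k _ => by split_ifs <;> linarith
  have h1 : ∀ ω, (∏ k : Fin n, if i (k * h) ω = i ((k + 1 : ℕ) * h) ω then 1 else κ) = F (X ω) := by
    intro ω
    simp [hF, hX]
  simp only [h1]
  rw [← lintegral_map (μ := P) (f := fun x => ENNReal.ofReal (F x)) (.of_discrete) hXm,
    lintegral_fintype]
  have h2 : ∀ x, ENNReal.ofReal (F x) * P.map X {x} = ENNReal.ofReal ((1 / N) *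
      ∏ k : Fin n, NormedSpace.exp (h • rateMatrix N γ) (x k.castSucc) (x k.succ) *
        (if x k.castSucc = x k.succ then 1 else κ)) := by
    intro x
    have hm := hi.markov n (fun k => k * h) x
      (fun a b hab => mul_le_mul_of_nonneg_right (by exact_mod_cast hab) hh) (by simp)
    have hs : X ⁻¹' {x} = {ω | ∀ k : Fin (n + 1), i (k * h) ω = x k} := by
      ext ω; simp [hX, funext_iff]
    rw [Measure.map_apply hXm (measurableSet_singleton x), hs, ← ofReal_measureReal,
      ← ENNReal.ofReal_mul (hF0 x), hm, hi.initial_uniform, Finset.prod_mul_distrib]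
    congr 1
    have h3 : ∀ k : Fin n, ((k.succ : ℕ) : ℝ) * h - (k.castSucc : ℕ) * h = h := by
      intro k; simp; ring
    simp only [h3]
    ring
  have hQ0 : ∀ a b, 0 ≤ NormedSpace.exp (h • rateMatrix N γ) a b *
      (if a = b then 1 else κ) := by
    intro a b
    have he : Real.exp (-(N * γ * h)) ≤ 1 := Real.exp_le_one_iff.2 (by simp; positivity)
    refine mul_nonneg ?_ (by split_ifs <;> linarith)
    rw [exp_smul_rateMatrix hN]
    refine add_nonneg (by split_ifs <;> positivity) (div_nonneg (by linarith) hN0.le)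
  simp only [h2]
  rw [← ENNReal.ofReal_sum_of_nonneg fun x _ => mul_nonneg (by positivity)
    (Finset.prod_nonneg fun k _ => hQ0 _ _), ← Finset.mul_sum,
    sum_prod_path (fun a b => NormedSpace.exp (h • rateMatrix N γ) a b *
      (if a = b then 1 else κ)) _ (sum_exp_smul_rateMatrix_mul hN γ h κ) n, Fintype.card_fin,
    ← mul_assoc, one_div, inv_mul_cancel₀ hN0.ne', one_mul]
  refine ENNReal.ofReal_le_ofReal ?_
  have hpow : Real.exp ((κ - 1) * N * γ * (n * h)) = Real.exp ((κ - 1) * N * γ * h) ^ n := by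
    rw [← Real.exp_nat_mul]; ring_nf
  rw [hpow]
  have he1 : Real.exp (-(N * γ * h)) ≤ 1 := Real.exp_le_one_iff.2 (by simp; positivity)
  have he2 := Real.add_one_le_exp (-(N * γ * h))
  have hN1 : (1 : ℝ) ≤ N := by exact_mod_cast hN
  -- The change probability is at most `N γ h`, so one step costs at most `1 + (κ - 1) N γ h`, hence
  -- at most the exponential.
  have hb : (1 - Real.exp (-(N * γ * h))) * (N - 1) / N ≤ N * γ * h := by
    rw [div_le_iff₀ hN0]
    exact mul_le_mul (by linarith) (by linarith) (by linarith) (by positivity)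
  refine pow_le_pow_left₀ ?_ ?_ n
  · have : 0 ≤ (1 - Real.exp (-(N * γ * h))) * (N - 1) / N :=
      div_nonneg (mul_nonneg (by linarith) (by linarith)) hN0.le
    have := mul_nonneg (sub_nonneg.2 hκ) this
    linarith
  · have h5 := Real.add_one_le_exp ((κ - 1) * N * γ * h)
    have h6 := mul_le_mul_of_nonneg_left hb (sub_nonneg.2 hκ)
    nlinarith

end MarkovChain

/-! ### The Lyapunov energy of the momentum dynamics -/

section Energy

variable {E : Type*} [NormedAddCommGroup E] [InnerProductSpace ℝ E]

/-- The energy of the momentum dynamics with potential `f` and reference point `x`. -/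
noncomputable def momentumEnergy (f : E → ℝ) (x : E) (m : ℝ) (q p : E) : ℝ :=
  2 * m * (f q - f x) + ‖q - x + m • p‖ ^ 2 / 2 + ‖m • p‖ ^ 2 / 2

theorem norm_sub_sq_le_momentumEnergy {f : E → ℝ} {x : E} {m : ℝ} (hm : 0 ≤ m)
    (hx : ∀ y, f x ≤ f y) (q p : E) : ‖q - x‖ ^ 2 ≤ 4 * momentumEnergy f x m q p := by
  have h1 : ‖q - x‖ ≤ ‖q - x + m • p‖ + ‖m • p‖ := by
    simpa using norm_sub_le (q - x + m • p) (m • p)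
  have h2 := pow_le_pow_left₀ (norm_nonneg _) h1 2
  have h3 := mul_nonneg hm (sub_nonneg.2 (hx q))
  unfold momentumEnergy
  nlinarith [sq_nonneg (‖q - x + m • p‖ - ‖m • p‖)]

theorem norm_smul_sq_le_momentumEnergy {f : E → ℝ} {x : E} {m : ℝ} (hm : 0 ≤ m)
    (hx : ∀ y, f x ≤ f y) (q p : E) : ‖m • p‖ ^ 2 ≤ 2 * momentumEnergy f x m q p := by
  have h3 := mul_nonneg hm (sub_nonneg.2 (hx q))
  unfold momentumEnergy
  nlinarith [sq_nonneg ‖q - x + m • p‖]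

theorem momentumEnergy_le {f : E → ℝ} {x : E} {m l : ℝ} (hm : 0 ≤ m) (hm1 : m ≤ 1)
    (hl : 0 ≤ l) {q : E} (hq : f q - f x ≤ l * ‖q - x‖ ^ 2) (p : E) :
    momentumEnergy f x m q p ≤ (2 * l + 1) * ‖q - x‖ ^ 2 + 3 / 2 * ‖m • p‖ ^ 2 := by
  have h1 := pow_le_pow_left₀ (norm_nonneg _) (norm_add_le (q - x) (m • p)) 2
  have h2 := mul_le_mul_of_nonneg_left hq hm
  have h3 : m * (l * ‖q - x‖ ^ 2) ≤ l * ‖q - x‖ ^ 2 := mul_le_of_le_one_left (by positivity) hm1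
  unfold momentumEnergy
  nlinarith [sq_nonneg (‖q - x‖ - ‖m • p‖)]

/-- Changing the potential increases the shifted energy by a constant factor at most. -/
theorem momentumEnergy_switch {f g : E → ℝ} {x y : E} {m l R : ℝ} (hm : 0 ≤ m) (hm1 : m ≤ 1)
    (hl : 0 ≤ l) (hx : ∀ z, f x ≤ f z) {q : E} (hq : g q - g y ≤ l * ‖q - y‖ ^ 2)
    (hxR : ‖x‖ ≤ R) (hyR : ‖y‖ ≤ R) (p : E) :
    momentumEnergy g y m q p + R ^ 2 ≤ (16 * l + 12) * (momentumEnergy f x m q p + R ^ 2) := by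
  have h1 := momentumEnergy_le hm hm1 hl hq p
  have h2 := norm_sub_sq_le_momentumEnergy hm hx q p
  have h3 := norm_smul_sq_le_momentumEnergy hm hx q p
  have h4 : ‖q - y‖ ≤ ‖q - x‖ + 2 * R := by
    have := norm_sub_le_norm_sub_add_norm_sub q x y
    linarith [norm_sub_le x y]
  -- The shift `R ^ 2` pays for moving the reference point. With this `8`, the factor is `8 * (2 * l
  -- + 1) + 3 + 1 = 16 * l + 12`.
  have h5 : ‖q - y‖ ^ 2 ≤ 8 * (momentumEnergy f x m q p + R ^ 2) := by
    have := pow_le_pow_left₀ (norm_nonneg _) h4 2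
    nlinarith [sq_nonneg (‖q - x‖ - 2 * R)]
  have h6 := mul_le_mul_of_nonneg_left h5 (show 0 ≤ 2 * l + 1 by positivity)
  nlinarith [sq_nonneg R]

/-- The weight `2 * m` of the potential cancels the products of `p` with the gradient; the
derivative that remains is `-⟪q - x, ∇f(q)⟫ - m ‖p‖²`. -/
theorem IsMomentumFlow.momentumEnergy_antitone [CompleteSpace E] {A : ℝ → E → E} {m T : ℝ}
    {q p : ℝ → E} (h : IsMomentumFlow A m T q p) (hm : 0 < m) {f : E → ℝ}
    (hf : Differentiable ℝ f) {x : E}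
    (hx : ∀ y, 0 ≤ inner ℝ (y - x) (gradient f y)) {a b : ℝ} (ha : 0 ≤ a) (hb : b ≤ T)
    (hA : ∀ s ∈ Ico a b, A s = gradient f) {t : ℝ} (ht : t ∈ Icc a b) :
    momentumEnergy f x m (q t) (p t) ≤ momentumEnergy f x m (q a) (p a) := by
  have hsub : Icc a b ⊆ Icc 0 T := Icc_subset_Icc ha hb
  have hsub' : Ico a b ⊆ Ico 0 T := Ico_subset_Ico ha hb
  have h1 := h.continuousOn_q.mono hsub
  have h2 := h.continuousOn_p.mono hsub
  refine image_le_of_deriv_right_le_deriv_boundary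
    (f := fun s => momentumEnergy f x m (q s) (p s))
    (f' := fun s => 2 * m * inner ℝ (gradient f (q s)) (p s) +
      2 * inner ℝ (q s - x + m • p s) (p s + (-A s (q s) - p s)) / 2 +
      2 * inner ℝ (m • p s) (-A s (q s) - p s) / 2)
    (B := fun _ => momentumEnergy f x m (q a) (p a)) (B' := fun _ => 0) ?_ (fun s hs => ?_)
    le_rfl continuousOn_const (fun s _ => hasDerivWithinAt_const ..) (fun s hs => ?_) ht
  · have h3 : ContinuousOn (fun s => f (q s)) (Icc a b) := hf.continuous.comp_continuousOn h1
    have h4 : ContinuousOn (fun s => m • p s) (Icc a b) := h2.const_smul m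
    exact ((continuousOn_const.mul (h3.sub continuousOn_const)).add
      ((((h1.sub continuousOn_const).add h4).norm.pow 2).div_const 2)).add
      ((h4.norm.pow 2).div_const 2)
  · have hq := h.deriv_q s (hsub' hs)
    have hp := h.deriv_p s (hsub' hs)
    exact (((((hf (q s)).hasGradientAt.comp_hasDerivWithinAt hq).sub_const _).const_mul _).add
      (((hq.sub_const x).add hp).norm_sq.div_const 2)).add (hp.norm_sq.div_const 2)
  · have e1 := hx (q s)
    have e2 : 0 ≤ m * inner ℝ (p s) (p s) := mul_nonneg hm.le real_inner_self_nonneg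
    rw [hA s hs]
    simp only [add_sub_cancel, inner_sub_right, inner_neg_right, inner_add_left,
      real_inner_smul_left, real_inner_comm (p s) (gradient f (q s))]
    rw [real_inner_comm]
    linarith

end Energy

/-! ### Jumps of càdlàg paths and growth across them -/

section Switching

/-- Functions that are right-continuous with left limits for the discrete topology have at most one
jump in short intervals. -/
theorem exists_pos_forall_single_jump {α : Type*} [TopologicalSpace α] [DiscreteTopology α]
    {σ : ℝ → α} (hr : ∀ t, 0 ≤ t → ContinuousWithinAt σ (Ici t) t)
    (hl : ∀ t, 0 < t → ∃ j, Tendsto σ (𝓝[<] t) (𝓝 j)) (T : ℝ) :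
    ∃ ε > 0, ∀ s t, 0 ≤ s → s ≤ t → t ≤ T → t - s < ε →
      ∃ u ∈ Icc s t, (∀ v ∈ Ico s u, σ v = σ s) ∧ ∀ v ∈ Icc u t, σ v = σ t := by
  have hloc : ∀ x : Icc (0 : ℝ) T, ∃ δ > 0, (∃ j, ∀ v : ℝ, 0 ≤ v → v ∈ Ioo ((x : ℝ) - δ) x → σ v = j) ∧
      ∀ v ∈ Ico (x : ℝ) (x + δ), σ v = σ x := by
    rintro ⟨x, hx0, hxT⟩
    have h1 : ∀ᶠ v in 𝓝[≥] x, σ v = σ x := by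
      have := hr x hx0
      rw [ContinuousWithinAt, nhds_discrete, tendsto_pure] at this
      exact this
    obtain ⟨b, hb, hb'⟩ := (mem_nhdsGE_iff_exists_Ico_subset' (lt_add_one x)).1 h1
    -- The guard `0 ≤ v` makes the left-hand condition void at `x = 0`, where no left limit is
    -- assumed.
    obtain ⟨δ', hδ', j, hj⟩ : ∃ δ' > 0, ∃ j, ∀ v, 0 ≤ v → v ∈ Ioo (x - δ') x → σ v = j := by
      rcases hx0.eq_or_lt with rfl | hx
      · exact ⟨1, one_pos, σ 0, fun v h0 hv => absurd h0 (not_le.2 hv.2)⟩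
      · obtain ⟨j, hj⟩ := hl x hx
        rw [nhds_discrete, tendsto_pure] at hj
        obtain ⟨a, ha, ha'⟩ := (mem_nhdsLT_iff_exists_Ioo_subset' (sub_one_lt x)).1 hj
        exact ⟨x - a, sub_pos.2 ha, j, fun v _ hv => ha' ⟨by linarith [hv.1], hv.2⟩⟩
    refine ⟨min δ' (b - x), lt_min hδ' (sub_pos.2 hb), ⟨j, fun v h0 hv => hj v h0 ⟨?_, hv.2⟩⟩,
      fun v hv => hb' ⟨hv.1, ?_⟩⟩
    · have := min_le_left δ' (b - x)
      linarith [hv.1]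
    · have := min_le_right δ' (b - x)
      linarith [hv.2]
  choose δ hδ hleft hright using hloc
  obtain ⟨ε, hε, hcov⟩ := lebesgue_number_lemma_of_metric (isCompact_Icc (a := (0 : ℝ)) (b := T))
    (c := fun x : Icc (0 : ℝ) T => Metric.ball (x : ℝ) (δ x)) (fun _ => Metric.isOpen_ball)
    (fun x hx => mem_iUnion.2 ⟨⟨x, hx⟩, Metric.mem_ball_self (hδ _)⟩)
  refine ⟨ε, hε, fun s t hs hst ht hlt => ?_⟩
  obtain ⟨x, hx⟩ := hcov s ⟨hs, hst.trans ht⟩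
  have hmem : ∀ v ∈ Icc s t, v ∈ Ioo ((x : ℝ) - δ x) (x + δ x) := by
    intro v hv
    rw [← Real.ball_eq_Ioo]
    refine hx ?_
    rw [Real.ball_eq_Ioo]
    exact ⟨by linarith [hv.1], by linarith [hv.2]⟩
  obtain ⟨j, hj⟩ := hleft x
  have hL : ∀ v ∈ Icc s t, v < x → σ v = j := fun v hv hvx =>
    hj v (hs.trans hv.1) ⟨(hmem v hv).1, hvx⟩
  have hR : ∀ v ∈ Icc s t, (x : ℝ) ≤ v → σ v = σ x := fun v hv hvx =>
    hright x v ⟨hvx, (hmem v hv).2⟩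
  have hss : s ∈ Icc s t := left_mem_Icc.2 hst
  have htt : t ∈ Icc s t := right_mem_Icc.2 hst
  rcases lt_or_ge (x : ℝ) s with h1 | h1
  · refine ⟨s, hss, fun v hv => absurd hv.1 (not_le.2 hv.2), fun v hv => ?_⟩
    rw [hR v hv (h1.le.trans hv.1), hR t htt (h1.le.trans hst)]
  rcases le_or_gt (x : ℝ) t with h2 | h2
  · refine ⟨x, ⟨h1, h2⟩, fun v hv => ?_, fun v hv => ?_⟩
    · rw [hL v ⟨hv.1, hv.2.le.trans h2⟩ hv.2, hL s hss (hv.1.trans_lt hv.2)]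
    · rw [hR v ⟨h1.trans hv.1, hv.2⟩ hv.1, hR t htt h2]
  · refine ⟨s, hss, fun v hv => absurd hv.1 (not_le.2 hv.2), fun v hv => ?_⟩
    rw [hL v hv (hv.2.trans_lt h2), hL t htt h2]

/-- A family of weights, each nonincreasing while its index is active and comparable up to the
factor `κ`, grows at most by the factor `κ` per change of the index along a fine grid. -/
theorem weight_le_prod_mul {ι : Type*} [DecidableEq ι] {σ : ℝ → ι} {W : ι → ℝ → ℝ} {κ T h : ℝ}
    (hκ : 1 ≤ κ) (hW0 : ∀ j t, 0 ≤ W j t) (hWκ : ∀ i j t, W j t ≤ κ * W i t)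
    (hW : ∀ j a b, 0 ≤ a → b ≤ T → (∀ s ∈ Ico a b, σ s = j) → ∀ t ∈ Icc a b, W j t ≤ W j a)
    (hh : 0 ≤ h) {n : ℕ} (hn : n * h ≤ T)
    (hσ : ∀ k < n, ∃ u ∈ Icc (k * h) ((k + 1 : ℕ) * h),
      (∀ v ∈ Ico (k * h) u, σ v = σ (k * h)) ∧
      ∀ v ∈ Icc u ((k + 1 : ℕ) * h), σ v = σ ((k + 1 : ℕ) * h))
    {t : ℝ} (ht : t ∈ Icc 0 (n * h)) :
    W (σ t) t ≤ (∏ k ∈ Finset.range n, if σ (k * h) = σ ((k + 1 : ℕ) * h) then 1 else κ) *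
      W (σ 0) 0 := by
  induction n generalizing t with
  | zero =>
    have : t = 0 := by simpa using ht
    simp [this]
  | succ n ih =>
    have hle : (n : ℝ) * h ≤ (n + 1 : ℕ) * h := by push_cast; linarith
    have ih' := fun {t} => ih (hle.trans hn) (fun k hk => hσ k (hk.trans n.lt_succ_self)) (t := t)
    set Pn := ∏ k ∈ Finset.range n, if σ (k * h) = σ ((k + 1 : ℕ) * h) then 1 else κ with hPn
    have hP0 : 0 ≤ Pn := Finset.prod_nonneg fun k _ => by split_ifs <;> linarith
    have hX0 : 0 ≤ Pn * W (σ 0) 0 := mul_nonneg hP0 (hW0 _ _)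
    rw [Finset.prod_range_succ, ← hPn]
    set c : ℝ := if σ (n * h) = σ ((n + 1 : ℕ) * h) then 1 else κ with hc
    have hc1 : 1 ≤ c := by rw [hc]; split_ifs <;> linarith
    have hgrow : Pn * W (σ 0) 0 ≤ Pn * c * W (σ 0) 0 := by nlinarith
    rcases le_or_gt t (n * h) with htn | htn
    · exact (ih' ⟨ht.1, htn⟩).trans hgrow
    have hn0 : 0 ≤ (n : ℝ) * h := by positivity
    have h0 := ih' (t := n * h) ⟨hn0, le_rfl⟩
    obtain ⟨u, hu, hu1, hu2⟩ := hσ n n.lt_succ_self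
    have hW1 : ∀ v ∈ Icc (n * h) u, W (σ (n * h)) v ≤ W (σ (n * h)) (n * h) :=
      hW _ _ _ hn0 (hu.2.trans hn) hu1
    rcases lt_or_ge t u with htu | htu
    · rw [hu1 t ⟨htn.le, htu⟩]
      exact ((hW1 t ⟨htn.le, htu.le⟩).trans h0).trans hgrow
    · rw [hu2 t ⟨htu, ht.2⟩]
      have h1 := hW _ u ((n + 1 : ℕ) * h) (hn0.trans hu.1) hn
        (fun v hv => hu2 v (Ico_subset_Icc_self hv)) t ⟨htu, ht.2⟩
      -- The single possible switch in the cell, at `u`, costs `κ`; nothing is paid if the endpoint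
      -- indices agree.
      have h2 : W (σ ((n + 1 : ℕ) * h)) u ≤ c * W (σ (n * h)) u := by
        rw [hc]
        split_ifs with heq
        · rw [heq, one_mul]
        · exact hWκ _ _ _
      have h3 := (hW1 u ⟨hu.1, le_rfl⟩).trans h0
      have h4 := mul_le_mul_of_nonneg_left h3 (zero_le_one.trans hc1)
      linarith

end Switching

/-! ### From integral equations to flows with switching potentials -/

section Paths

variable {E : Type*} [NormedAddCommGroup E] {ι : Type*} {σ : ℝ → ι} {G : ι → E → E} {q p θ : ℝ → E}

theorem norm_switching_le [Fintype ι] (s : ℝ) : ‖G (σ s) (q s)‖ ≤ ∑ j, ‖G j (q s)‖ :=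
  Finset.single_le_sum (f := fun j => ‖G j (q s)‖) (fun _ _ => norm_nonneg _)
    (Finset.mem_univ (σ s))

theorem continuousOn_sum_norm [Fintype ι] (hG : ∀ j, Continuous (G j)) (hq : ContinuousOn q (Ici 0)) :
    ContinuousOn (fun s => ∑ j, ‖G j (q s)‖) (Ici 0) :=
  continuousOn_finsetSum _ fun j _ => ((hG j).comp_continuousOn hq).norm

variable [TopologicalSpace ι] [DiscreteTopology ι]

theorem continuousWithinAt_switching (hσ : ∀ t, 0 ≤ t → ContinuousWithinAt σ (Ici t) t)
    (hG : ∀ j, Continuous (G j)) (hq : ContinuousOn q (Ici 0)) {t : ℝ} (ht : 0 ≤ t) :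
    ContinuousWithinAt (fun s => G (σ s) (q s)) (Ici t) t := by
  have h1 : ∀ᶠ s in 𝓝[≥] t, σ s = σ t := by
    have := hσ t ht
    rw [ContinuousWithinAt, nhds_discrete, tendsto_pure] at this
    exact this
  have h2 : ContinuousWithinAt (fun s => G (σ t) (q s)) (Ici t) t :=
    (hG (σ t)).continuousAt.comp_continuousWithinAt ((hq t ht).mono (Ici_subset_Ici.2 ht))
  exact h2.congr_of_eventuallyEq (h1.mono fun s hs => by simp only [hs]) rfl

variable [InnerProductSpace ℝ E] [CompleteSpace E]

theorem isDescentFlow_of_integral [Fintype ι] (hσ : ∀ t, 0 ≤ t → ContinuousWithinAt σ (Ici t) t)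
    (hG : ∀ j, Continuous (G j)) (hθ : ContinuousOn θ (Ici 0)) {θ₀ : E}
    (h : ∀ t, 0 ≤ t → θ t = θ₀ + ∫ s in (0 : ℝ)..t, -G (σ s) (θ s)) (T : ℝ) :
    IsDescentFlow (fun t => G (σ t)) T θ where
  continuousOn := hθ.mono Icc_subset_Ici_self
  deriv t ht := by
    have h1 := hasDerivWithinAt_integral_of_rightContinuous (f := fun s => -G (σ s) (θ s))
      (fun t ht => (continuousWithinAt_switching hσ hG hθ ht).neg) (continuousOn_sum_norm hG hθ)
      (fun s _ => (norm_neg _).trans_le (norm_switching_le s)) ht.1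
    exact (h1.const_add θ₀).congr (fun s hs => h s (ht.1.trans hs)) (h t ht.1)

theorem isMomentumFlow_of_integral [Fintype ι] (hσ : ∀ t, 0 ≤ t → ContinuousWithinAt σ (Ici t) t)
    (hG : ∀ j, Continuous (G j)) (hq : ContinuousOn q (Ici 0)) (hp : ContinuousOn p (Ici 0))
    {q₀ p₀ : E} {m : ℝ} (h : ∀ t, 0 ≤ t → q t = q₀ + ∫ s in (0 : ℝ)..t, p s)
    (h' : ∀ t, 0 ≤ t → m • p t = m • p₀ + ∫ s in (0 : ℝ)..t, (-G (σ s) (q s) - (1 : ℝ) • p s))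
    (T : ℝ) : IsMomentumFlow (fun t => G (σ t)) m T q p where
  continuousOn_q := hq.mono Icc_subset_Ici_self
  continuousOn_p := hp.mono Icc_subset_Ici_self
  deriv_q t ht := by
    have h1 := hasDerivWithinAt_integral_of_rightContinuous
      (fun t ht => (hp t ht).mono (Ici_subset_Ici.2 ht)) hp.norm (fun s _ => le_rfl) ht.1
    exact (h1.const_add q₀).congr (fun s hs => h s (ht.1.trans hs)) (h t ht.1)
  deriv_p t ht := by
    simp only [one_smul] at h'
    have h1 := hasDerivWithinAt_integral_of_rightContinuous (f := fun s => -G (σ s) (q s) - p s)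
      (fun t ht => (continuousWithinAt_switching hσ hG hq ht).neg.sub
        ((hp t ht).mono (Ici_subset_Ici.2 ht)))
      ((continuousOn_sum_norm hG hq).add hp.norm)
      (fun s _ => (norm_sub_le _ _).trans
        (add_le_add_left ((norm_neg _).trans_le (norm_switching_le s)) _)) ht.1
    exact (h1.const_add (m • p₀)).congr (fun s hs => h' s (ht.1.trans hs)) (h' t ht.1)

/-- The growth of the momentum dynamics with switching potentials: along fine grids, it is
controlled by the number of changes of the potential. -/
theorem IsMomentumFlow.eventually_norm_sub_le_prod [DecidableEq ι] {Φ : ι → E → ℝ} {m T : ℝ}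
    {L : ℝ≥0} (h : IsMomentumFlow (fun t => gradient (Φ (σ t))) m T q p) (hm : 0 < m)
    (hm1 : m ≤ 1) (hT : 0 < T) (hΦ : ∀ j, Differentiable ℝ (Φ j))
    (hconv : ∀ j, ConvexOn ℝ univ (Φ j)) (hL : ∀ j, LipschitzWith L (gradient (Φ j)))
    {x : ι → E} (hx : ∀ j y, Φ j (x j) ≤ Φ j y)
    (hσr : ∀ t, 0 ≤ t → ContinuousWithinAt σ (Ici t) t)
    (hσl : ∀ t, 0 < t → ∃ j, Tendsto σ (𝓝[<] t) (𝓝 j)) {R S : ℝ} (hxR : ∀ j, ‖x j‖ ≤ R)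
    (hq0 : ‖q 0 - x (σ 0)‖ ≤ S) (hp0 : m * ‖p 0‖ ≤ S) (hRS : R ≤ S) :
    ∀ᶠ n : ℕ in atTop, ∀ t ∈ Icc 0 T, ‖q t - x (σ t)‖ ≤
      (4 * L + 8) * S * ∏ k ∈ Finset.range (n + 1),
        if σ (k * (T / (n + 1 : ℕ))) = σ ((k + 1 : ℕ) * (T / (n + 1 : ℕ))) then 1
        else 16 * (L : ℝ) + 12 := by
  have hL0 : (0 : ℝ) ≤ L := L.2
  have hR0 : 0 ≤ R := (norm_nonneg _).trans (hxR (σ 0))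
  have hS0 : 0 ≤ S := hR0.trans hRS
  have hbound : ∀ j y, Φ j y - Φ j (x j) ≤ L * ‖y - x j‖ ^ 2 := fun j y =>
    (hconv j).sub_le_of_lipschitz_gradient (hΦ j) (hL j) (hx j) y
  have hdiss : ∀ j y, 0 ≤ inner ℝ (y - x j) (gradient (Φ j) y) := fun j y => by
    simpa [gradient_eq_zero_of_forall_le (hx j)] using
      (hconv j).inner_gradient_sub_nonneg (hΦ j) y (x j)
  obtain ⟨ε, hε, hjump⟩ := exists_pos_forall_single_jump hσr hσl T
  have hlim : Tendsto (fun n : ℕ => T / (n + 1 : ℕ)) atTop (𝓝 0) :=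
    (tendsto_const_div_atTop_nhds_zero_nat T).comp (tendsto_add_atTop_nat 1)
  filter_upwards [hlim.eventually (gt_mem_nhds hε)] with n hn t ht
  have hnT : ((n + 1 : ℕ) : ℝ) * (T / (n + 1 : ℕ)) = T := by field_simp
  have hh0 : 0 ≤ T / (n + 1 : ℕ) := by positivity
  have hcell : ∀ k < n + 1, ∃ u ∈ Icc (k * (T / (n + 1 : ℕ))) ((k + 1 : ℕ) * (T / (n + 1 : ℕ))),
      (∀ v ∈ Ico (k * (T / (n + 1 : ℕ))) u, σ v = σ (k * (T / (n + 1 : ℕ)))) ∧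
      ∀ v ∈ Icc u ((k + 1 : ℕ) * (T / (n + 1 : ℕ))),
        σ v = σ ((k + 1 : ℕ) * (T / (n + 1 : ℕ))) := by
    intro k hk
    have hk' : ((k + 1 : ℕ) : ℝ) ≤ (n + 1 : ℕ) := by exact_mod_cast hk
    have hkT := (mul_le_mul_of_nonneg_right hk' hh0).trans_eq hnT
    have hstep : ((k + 1 : ℕ) : ℝ) * (T / (n + 1 : ℕ)) =
        k * (T / (n + 1 : ℕ)) + T / (n + 1 : ℕ) := by
      rw [Nat.cast_succ, add_one_mul]
    exact hjump _ _ (by positivity) (by linarith) hkT (by linarith)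
  have key := weight_le_prod_mul (σ := σ) (κ := 16 * L + 12) (h := T / (n + 1 : ℕ))
    (W := fun j t => momentumEnergy (Φ j) (x j) m (q t) (p t) + R ^ 2) (by linarith)
    (fun j t => by
      have := norm_sub_sq_le_momentumEnergy hm.le (hx j) (q t) (p t)
      nlinarith [sq_nonneg ‖q t - x j‖, sq_nonneg R])
    (fun i j t => momentumEnergy_switch hm.le hm1 hL0 (hx i) (hbound j _) (hxR i) (hxR j) _)
    (fun j a b ha hb hab t ht => add_le_add_left
      (h.momentumEnergy_antitone hm (hΦ j) (hdiss j) ha hb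
        (fun s hs => by simp only [hab s hs]) ht) _)
    hh0 hnT.le hcell
    (t := t) (by rwa [hnT])
  set Q := ∏ k ∈ Finset.range (n + 1),
    if σ (k * (T / (n + 1 : ℕ))) = σ ((k + 1 : ℕ) * (T / (n + 1 : ℕ))) then 1
    else 16 * (L : ℝ) + 12 with hQ
  have hQ1 : 1 ≤ Q := Finset.prod_induction _ (1 ≤ ·)
    (fun _ _ => one_le_mul_of_one_le_of_one_le) le_rfl fun k _ => by split_ifs <;> linarith
  have h1 := norm_sub_sq_le_momentumEnergy hm.le (hx (σ t)) (q t) (p t)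
  have h2 := momentumEnergy_le hm.le hm1 hL0 (hbound (σ 0) (q 0)) (p 0)
  rw [norm_smul, Real.norm_of_nonneg hm.le] at h2
  have h3 : momentumEnergy (Φ (σ 0)) (x (σ 0)) m (q 0) (p 0) + R ^ 2 ≤ (2 * L + 4) * S ^ 2 := by
    have e1 := pow_le_pow_left₀ (norm_nonneg _) hq0 2
    have e2 := pow_le_pow_left₀ (by positivity) hp0 2
    have e3 := pow_le_pow_left₀ hR0 hRS 2
    nlinarith
  have h4 := mul_le_mul_of_nonneg_left h3 (zero_le_one.trans hQ1)
  refine abs_le_of_sq_le_sq' ?_ (by positivity) |>.2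
  -- As `Q * (2 * L + 4) ≥ 1`, its square root is replaced by itself; with the factor `4` from the
  -- energy this gives `4 * L + 8`.
  have h5 : Q * ((2 * L + 4) * S ^ 2) ≤ (Q * (2 * L + 4)) ^ 2 * S ^ 2 := by
    rw [← mul_assoc]
    exact mul_le_mul_of_nonneg_right (le_self_pow₀
      (one_le_mul_of_one_le_of_one_le hQ1 (by linarith)) two_ne_zero) (sq_nonneg S)
  nlinarith [sq_nonneg R]

end Paths

/-! ### Pathwise and expected bounds for the processes -/

section MainTheorem

/-- The exponential estimate enters only through the gradient bound along `q`, so its prefactor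
lands in the term of order `m`. -/
theorem IsMomentumFlow.norm_sub_le_of_mul_le {E : Type*} [NormedAddCommGroup E]
    [InnerProductSpace ℝ E] {A : ℝ → E → E} {m T : ℝ} {q p θ : ℝ → E} {L : ℝ≥0}
    (h : IsMomentumFlow A m T q p) (hθ : IsDescentFlow A T θ) (hm : 0 < m)
    (hA : ∀ t, LipschitzWith L (A t))
    (hmono : ∀ t x y, 0 ≤ inner ℝ (x - y) (A t x - A t y)) {K c : ℝ} (hK0 : 0 ≤ K)
    (hK : ∀ t ∈ Ico 0 T, ‖A t (θ t)‖ ≤ K) (hc : m * T ≤ c) {t : ℝ} (ht : t ∈ Icc 0 T) :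
    ‖q t - θ t‖ ≤ (‖q 0 - θ 0‖ + m * ‖p 0‖) + m * (1 + L * T) *
      (L * (2 * Real.exp (4 * (L ^ 2 + 1) * c) * (‖q 0 - θ 0‖ + m * ‖p 0‖ + K)) + K) := by
  have ha : 0 ≤ ‖q 0 - θ 0‖ + m * ‖p 0‖ + K := by positivity
  refine h.norm_sub_le_linear hθ hm hA hmono (by positivity) (fun s hs => ?_) ht
  have h1 := h.norm_sub_le_exp hθ hm hA hmono hK0 hK (Ico_subset_Icc_self hs)
  have h2 : Real.exp (4 * (L ^ 2 + 1) * (m * T)) ≤ Real.exp (4 * (L ^ 2 + 1) * c) :=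
    Real.exp_le_exp.2 (mul_le_mul_of_nonneg_left hc (by positivity))
  have h3 := norm_le_norm_add_norm_sub' (A s (q s)) (A s (θ s))
  have h4 := (hA s).norm_sub_le (q s) (θ s)
  have h5 := h1.trans (mul_le_mul_of_nonneg_right (mul_le_mul_of_nonneg_left h2 zero_le_two) ha)
  have h6 := mul_le_mul_of_nonneg_left h5 (show (0 : ℝ) ≤ L from L.2)
  linarith [hK s hs]

variable {Ω : Type*} [MeasurableSpace Ω] {P : Measure Ω} {d N : ℕ} {Φ : Fin N → ParamSpace d → ℝ}
  {i : ℝ → Ω → Fin N} {γ m ν : ℝ} {q₀ p₀ θ₀ : ParamSpace d} {q p θ : ℝ → Ω → ParamSpace d}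

theorem IsIndexProcess.ae_cadlag_div (hi : IsIndexProcess P γ i) (hν : 0 < ν) :
    ∀ᵐ ω ∂P, (∀ t, 0 ≤ t → ContinuousWithinAt (fun s => i (s / ν) ω) (Ici t) t) ∧
      ∀ t, 0 < t → ∃ j, Tendsto (fun s => i (s / ν) ω) (𝓝[<] t) (𝓝 j) := by
  filter_upwards [hi.cadlag] with ω hω
  refine ⟨fun t ht => ?_, fun t ht => ?_⟩
  · exact (hω.1 (t / ν) (by positivity)).comp (f := fun s => s / ν) (by fun_prop)
      fun s hs => div_le_div_of_nonneg_right (mem_Ici.1 hs) hν.le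
  · obtain ⟨j, hj⟩ := hω.2 (t / ν) (by positivity)
    refine ⟨j, hj.comp (tendsto_nhdsWithin_iff.2 ⟨?_, ?_⟩)⟩
    · exact ((continuous_id.div_const ν).tendsto t).mono_left nhdsWithin_le_nhds
    · filter_upwards [self_mem_nhdsWithin] with s hs
      exact div_lt_div_of_pos_right hs hν

theorem IsHSGMP.ae_isMomentumFlow (hqp : IsHSGMP P Φ i 1 m ν q₀ p₀ q p)
    (hi : IsIndexProcess P γ i) (hm : 0 < m) (hν : 0 < ν)
    (hG : ∀ j, Continuous (gradient (Φ j))) (T : ℝ) :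
    ∀ᵐ ω ∂P, IsMomentumFlow (fun t => gradient (Φ (i (t / ν) ω))) m T (q · ω) (p · ω) ∧
      q 0 ω = q₀ ∧ p 0 ω = p₀ := by
  filter_upwards [hqp.path, hi.ae_cadlag_div hν] with ω ⟨hq, hp, h⟩ hσ
  refine ⟨isMomentumFlow_of_integral (σ := fun s => i (s / ν) ω) hσ.1 hG hq hp
    (fun t ht => (h t ht).1) (fun t ht => (h t ht).2) T, by simpa using (h 0 le_rfl).1, ?_⟩
  have := (h 0 le_rfl).2
  rw [intervalIntegral.integral_same, add_zero] at this
  exact smul_right_injective _ hm.ne' this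

theorem IsSGP.ae_isDescentFlow (hθ : IsSGP P Φ i ν θ₀ θ) (hi : IsIndexProcess P γ i)
    (hν : 0 < ν) (hG : ∀ j, Continuous (gradient (Φ j))) (T : ℝ) :
    ∀ᵐ ω ∂P, IsDescentFlow (fun t => gradient (Φ (i (t / ν) ω))) T (θ · ω) ∧ θ 0 ω = θ₀ := by
  filter_upwards [hθ.path, hi.ae_cadlag_div hν] with ω ⟨hc, h⟩ hσ
  exact ⟨isDescentFlow_of_integral (σ := fun s => i (s / ν) ω) hσ.1 hG hc h T,
    by simpa using h 0 le_rfl⟩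

/-- The expected supremum of a process whose growth is controlled by the number of changes of the
index process along fine grids. -/
theorem IsIndexProcess.lintegral_iSup_le [IsProbabilityMeasure P] (hi : IsIndexProcess P γ i)
    (hN : 1 ≤ N) (hγ : 0 < γ) (hν : 0 < ν) {T κ b : ℝ} (hT : 0 < T) (hκ : 1 ≤ κ) (hb : 0 ≤ b)
    {Z : ℝ → Ω → ParamSpace d}
    (hZ : ∀ᵐ ω ∂P, ∀ᶠ n : ℕ in atTop, ∀ t ∈ Icc 0 T, ‖Z t ω‖ ≤
      b * ∏ k ∈ Finset.range (n + 1), if i (k * (T / (n + 1 : ℕ)) / ν) ω =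
        i ((k + 1 : ℕ) * (T / (n + 1 : ℕ)) / ν) ω then 1 else κ) :
    ∫⁻ ω, ⨆ t ∈ Icc (0 : ℝ) T, ‖Z t ω‖ₑ ∂P ≤
      ENNReal.ofReal (b * Real.exp ((κ - 1) * N * γ * (T / ν))) := by
  set F : ℕ → Ω → ℝ≥0∞ := fun n ω => ENNReal.ofReal b *
    ENNReal.ofReal (∏ k : Fin (n + 1), if i (k * (T / (n + 1 : ℕ) / ν)) ω =
      i ((k + 1 : ℕ) * (T / (n + 1 : ℕ) / ν)) ω then 1 else κ) with hF
  have hFm : ∀ n, Measurable (F n) := by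
    intro n
    refine measurable_const.mul (Finset.measurable_prod _ fun k _ => ?_).ennreal_ofReal
    exact Measurable.ite (measurableSet_eq_fun (hi.measurable _ (by positivity))
      (hi.measurable _ (by positivity))) measurable_const measurable_const
  -- How fine the grid must be depends on the path, so only the liminf over grids is controlled, and
  -- Fatou's lemma is applied to it.
  have hle : ∀ᵐ ω ∂P, ⨆ t ∈ Icc (0 : ℝ) T, ‖Z t ω‖ₑ ≤ liminf (fun n => F n ω) atTop := by
    filter_upwards [hZ] with ω hω
    refine le_liminf_of_le (by isBoundedDefault) ?_
    filter_upwards [hω] with n hn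
    refine iSup₂_le fun t ht => ?_
    simp only [hF]
    rw [← ofReal_norm, ← ENNReal.ofReal_mul hb]
    refine ENNReal.ofReal_le_ofReal ((hn t ht).trans_eq ?_)
    rw [← Fin.prod_univ_eq_prod_range (fun k => if i (k * (T / (n + 1 : ℕ)) / ν) ω =
        i ((k + 1 : ℕ) * (T / (n + 1 : ℕ)) / ν) ω then (1 : ℝ) else κ)]
    simp only [mul_div_assoc]
  refine (lintegral_mono_ae hle).trans ((lintegral_liminf_le hFm).trans ?_)
  refine (liminf_le_liminf (v := fun _ => ENNReal.ofReal
    (b * Real.exp ((κ - 1) * N * γ * (T / ν)))) (Eventually.of_forall fun n => ?_)).trans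
    (liminf_const _).le
  have h1 := hi.lintegral_prod_le hN hγ hκ (h := T / (n + 1 : ℕ) / ν) (by positivity) (n + 1)
  have h2 : ((n + 1 : ℕ) : ℝ) * (T / (n + 1 : ℕ) / ν) = T / ν := by field_simp
  rw [h2] at h1
  simp only [hF]
  rw [lintegral_const_mul' _ _ ENNReal.ofReal_ne_top, ENNReal.ofReal_mul hb]
  gcongr

end MainTheorem

/-! ### Algebra of the error bound -/

section ErrorBound

theorem add_mul_le_sgmpErrorBound {C K γ δ T eq ep m : ℝ} {N : ℕ} (hC : 0 ≤ C) (hK : 0 ≤ K)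
    (hγ : 0 ≤ γ) (hT : 0 ≤ T) (heq : 0 ≤ eq) (hep : 0 ≤ ep) (hm : 0 ≤ m) :
    (eq + m * ep) + C * m * (1 + T) * ((eq + m * ep) + K) ≤
      sgmpErrorBound C K γ N δ T eq ep m := by
  have h1 : 1 ≤ Real.exp (m ^ (1 - δ) * T * (1 + T) * γ * N) :=
    Real.one_le_exp (by positivity)
  have ha : 0 ≤ eq + m * ep := by positivity
  have h2 : 0 ≤ (1 + C * m * (1 + T)) * (eq + m * ep) := by positivity
  unfold sgmpErrorBound
  nlinarith [mul_le_mul_of_nonneg_left h1 h2, mul_le_mul_of_nonneg_right h1 hK]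

/-- For large `m * (1 + T)` the term `C * m * (1 + T)` exceeds both the multiplicative constant `c`
and the `1` subtracted in the bracket. -/
theorem mul_exp_le_sgmpErrorBound {C K γ δ T eq ep m c H : ℝ} {N : ℕ}
    (hK : 0 ≤ K) (heq : 0 ≤ eq) (hep : 0 ≤ ep) (hm : 0 ≤ m) (hc : c ≤ C * m * (1 + T))
    (hc1 : 1 ≤ c) (hH : c * H ≤ K) :
    c * ((eq + m * ep) + H) * Real.exp (m ^ (1 - δ) * T * (1 + T) * γ * N) ≤
      sgmpErrorBound C K γ N δ T eq ep m := by
  have ha : 0 ≤ eq + m * ep := by positivity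
  unfold sgmpErrorBound
  set e := Real.exp (m ^ (1 - δ) * T * (1 + T) * γ * N)
  have he : 0 ≤ e := (Real.exp_pos _).le
  have h1 : c * (e * (eq + m * ep)) ≤ (1 + C * m * (1 + T)) * (e * (eq + m * ep)) :=
    mul_le_mul_of_nonneg_right (by linarith) (by positivity)
  have h2 : c * H * e ≤ K * e := mul_le_mul_of_nonneg_right hH he
  have h3 : K * e ≤ (e - 1 + C * m * (T + 1)) * K := by
    rw [mul_comm]
    exact mul_le_mul_of_nonneg_right (by linarith) hK
  linarith

theorem tendsto_sgmpErrorBound {C K γ δ T ep : ℝ} {N : ℕ} (hδ : δ < 1) :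
    Tendsto (fun m : ℝ => sgmpErrorBound C K γ N δ T 0 ep m) (𝓝[>] 0) (𝓝 0) := by
  have hpow : Continuous (fun m : ℝ => m ^ (1 - δ)) :=
    Real.continuous_rpow_const (by linarith)
  have hcont : Continuous (fun m : ℝ => sgmpErrorBound C K γ N δ T 0 ep m) := by
    unfold sgmpErrorBound
    fun_prop
  have h0 : sgmpErrorBound C K γ N δ T 0 ep 0 = 0 := by
    simp [sgmpErrorBound, Real.zero_rpow (sub_pos.2 hδ).ne']
  have := hcont.tendsto 0
  rw [h0] at this
  exact this.mono_left nhdsWithin_le_nhds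

end ErrorBound

/-! ### Assembly of the two regimes -/

theorem mainTheorem4 :
    ∀ L : ℝ≥0, ∃ C : ℝ, 0 < C ∧
      ∀ (d N : ℕ) (Φ : Fin N → ParamSpace d → ℝ), 1 ≤ N →
        (∀ j, ContDiff ℝ 1 (Φ j)) →
        (∀ j, LipschitzWith L (gradient (Φ j))) →
        (∀ j, ConvexOn ℝ univ (Φ j)) →
        (∀ j, DissipativityCondition 1 (Φ j)) →
      ∀ (T : ℝ) (θ₀ : ParamSpace d), 0 < T → ∃ K : ℝ, 0 < K ∧
        ∀ (γ δ : ℝ) (q₀ p₀ : ParamSpace d), 0 < γ → 0 ≤ δ → δ < 1 →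
          (∀ m : ℝ, 0 < m → m ≤ 1 →
            ∀ (Ω : Type*) [MeasurableSpace Ω] (P : Measure Ω) [IsProbabilityMeasure P]
              (i : ℝ → Ω → Fin N) (q p θ : ℝ → Ω → ParamSpace d),
              IsIndexProcess P γ i →
              IsHSGMP P Φ i 1 m (m ^ δ) q₀ p₀ q p →
              IsSGP P Φ i (m ^ δ) θ₀ θ →
              ∫⁻ ω, ⨆ t ∈ Icc (0 : ℝ) T, ‖q t ω - θ t ω‖ₑ ∂P ≤
                ENNReal.ofReal (sgmpErrorBound C K γ N δ T ‖q₀ - θ₀‖ ‖p₀‖ m)) ∧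
          (q₀ = θ₀ →
            Tendsto (fun m : ℝ => sgmpErrorBound C K γ N δ T ‖q₀ - θ₀‖ ‖p₀‖ m)
              (𝓝[>] 0) (𝓝 0)) := by
  intro L
  have hL0 : (0 : ℝ) ≤ L := L.2
  set e : ℝ := Real.exp (4 * (L ^ 2 + 1) * (16 * L + 11)) with he
  have he0 : 0 < e := Real.exp_pos _
  -- The first summand serves small `m * (1 + T)`, the second, `4 * L + 9`, serves large values.
  have hC : 0 < (1 + L) * (2 * L * e + 1) + (4 * (L : ℝ) + 9) := by positivity
  refine ⟨_, hC, fun d N Φ hN hsmooth hlip hconv hdiss T θ₀ hT => ?_⟩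
  set C : ℝ := (1 + L) * (2 * L * e + 1) + (4 * (L : ℝ) + 9) with hCdef
  have hdiff : ∀ j, Differentiable ℝ (Φ j) := fun j => (hsmooth j).differentiable one_ne_zero
  have hgc : ∀ j, Continuous (gradient (Φ j)) := fun j => (hlip j).continuous
  choose x _ hx _ _ _ using hdiss
  set R : ℝ := ∑ j, ‖x j‖ with hR
  have hxR : ∀ j, ‖x j‖ ≤ R := fun j =>
    Finset.single_le_sum (f := fun j => ‖x j‖) (fun _ _ => norm_nonneg _) (Finset.mem_univ j)
  have hR0 : 0 ≤ R := Finset.sum_nonneg fun _ _ => norm_nonneg _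
  set G : ℝ := ∑ j, ‖gradient (Φ j) θ₀‖ with hGdef
  have hGj : ∀ j, ‖gradient (Φ j) θ₀‖ ≤ G := fun j =>
    Finset.single_le_sum (f := fun j => ‖gradient (Φ j) θ₀‖) (fun _ _ => norm_nonneg _)
      (Finset.mem_univ j)
  have hG0 : 0 ≤ G := Finset.sum_nonneg fun _ _ => norm_nonneg _
  set B : ℝ := gronwallBound 0 L G T with hB
  have hB0 : 0 ≤ B := by
    have := gronwallBound_mono le_rfl hG0 hL0 hT.le
    rwa [gronwallBound_x0] at this
  set H : ℝ := ‖θ₀‖ + R + B with hH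
  have hH0 : 0 ≤ H := by positivity
  -- `L * B + G` bounds the gradients along `θ`; `H` bounds the distances among `θ`, `θ₀` and the
  -- minimizers; the final `1` ensures positivity.
  refine ⟨(L * B + G) + (4 * L + 9) * H + 1, by positivity,
    fun γ δ q₀ p₀ hγ _ hδ1 => ⟨fun m hm hm1 Ω _ P _ i q p θ hi hqp hθ => ?_, ?_⟩⟩
  swap
  · rintro rfl
    simpa using tendsto_sgmpErrorBound hδ1
  have hν : 0 < m ^ δ := Real.rpow_pos_of_pos hm δ
  have hA : ∀ᵐ ω ∂P, ∀ t ∈ Icc 0 T, ‖θ t ω - θ₀‖ ≤ B := by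
    filter_upwards [hθ.ae_isDescentFlow hi hν hgc T] with ω ⟨hθω, h0⟩ t ht
    have := hθω.norm_sub_le (fun _ => hlip _) hG0 (fun s _ => by rw [h0]; exact hGj _) ht
    rwa [h0] at this
  -- The threshold is `κ - 1` for the switching factor `κ = 16 * L + 12`.
  rcases le_total (m * (1 + T)) (16 * L + 11) with hcase | hcase
  · refine (lintegral_mono_ae (g := fun _ => ENNReal.ofReal _) ?_).trans_eq
      (by rw [lintegral_const, measure_univ, mul_one])
    filter_upwards [hqp.ae_isMomentumFlow hi hm hν hgc T, hθ.ae_isDescentFlow hi hν hgc T, hA]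
      with ω ⟨hqω, hq0, hp0⟩ ⟨hθω, hθ0⟩ hAω
    refine iSup₂_le fun t ht => ?_
    rw [← ofReal_norm]
    refine ENNReal.ofReal_le_ofReal (le_trans ?_ (add_mul_le_sgmpErrorBound hC.le (by positivity)
      hγ.le hT.le (norm_nonneg _) (norm_nonneg _) hm.le))
    have hgθ : ∀ s ∈ Ico 0 T, ‖gradient (Φ (i (s / m ^ δ) ω)) (θ s ω)‖ ≤ L * B + G := by
      intro s hs
      have h1 := norm_le_norm_add_norm_sub' (gradient (Φ (i (s / m ^ δ) ω)) (θ s ω))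
        (gradient (Φ (i (s / m ^ δ) ω)) θ₀)
      have h2 := (hlip (i (s / m ^ δ) ω)).norm_sub_le (θ s ω) θ₀
      have h3 := mul_le_mul_of_nonneg_left (hAω s (Ico_subset_Icc_self hs)) hL0
      linarith [hGj (i (s / m ^ δ) ω)]
    have h1 := hqω.norm_sub_le_of_mul_le hθω hm (fun _ => hlip _)
      (fun s y z => (hconv _).inner_gradient_sub_nonneg (hdiff _) y z) (by positivity) hgθ
      (c := 16 * L + 11) (by linarith) ht
    rw [hq0, hp0, hθ0, ← he] at h1
    refine h1.trans (add_le_add_right ?_ _)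
    set a := ‖q₀ - θ₀‖ + m * ‖p₀‖ with ha
    have ha0 : 0 ≤ a := by positivity
    have hg0 : 0 ≤ L * B + G := by positivity
    calc m * (1 + L * T) * (L * (2 * e * (a + (L * B + G))) + (L * B + G))
        ≤ m * ((1 + L) * (1 + T)) * ((2 * L * e + 1) * (a + (L * B + G))) := by
          gcongr
          · nlinarith
          · linarith
      _ = (1 + L) * (2 * L * e + 1) * m * (1 + T) * (a + (L * B + G)) := by ring
      _ ≤ C * m * (1 + T) * (a + (L * B + G + (4 * L + 9) * H + 1)) := by
          have h2 : 0 ≤ (4 * (L : ℝ) + 9) * H := by positivity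
          have h3 : (1 + L) * (2 * L * e + 1) ≤ C := by rw [hCdef]; linarith
          exact mul_le_mul (mul_le_mul_of_nonneg_right (mul_le_mul_of_nonneg_right h3 hm.le)
            (by positivity)) (by linarith) (by positivity) (by positivity)
  · set S : ℝ := (‖q₀ - θ₀‖ + m * ‖p₀‖) + H with hS
    have hS0 : 0 ≤ S := by positivity
    -- Here `q` and `θ` are each compared with the minimizer of the active potential: `4 * L + 8`
    -- for `q` plus `1` for `θ` gives `4 * L + 9`.
    have hprod := hi.lintegral_iSup_le hN hγ hν hT (κ := 16 * L + 12) (b := (4 * L + 9) * S)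
      (Z := fun t ω => q t ω - θ t ω) (by linarith) (by positivity) (by
      filter_upwards [hqp.ae_isMomentumFlow hi hm hν hgc T, hi.ae_cadlag_div hν, hA]
        with ω ⟨hqω, hq0, hp0⟩ hσ hAω
      have hq0S : ‖q 0 ω - x (i (0 / m ^ δ) ω)‖ ≤ S := by
        have h1 := norm_sub_le_norm_sub_add_norm_sub q₀ θ₀ (x (i (0 / m ^ δ) ω))
        have h2 := norm_sub_le θ₀ (x (i (0 / m ^ δ) ω))
        have h3 : 0 ≤ m * ‖p₀‖ := by positivity
        rw [hq0]
        linarith [hxR (i (0 / m ^ δ) ω)]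
      have hp0S : m * ‖p 0 ω‖ ≤ S := by
        rw [hp0]
        linarith [norm_nonneg (q₀ - θ₀)]
      have hRS : R ≤ S := by
        have h3 : 0 ≤ m * ‖p₀‖ := by positivity
        linarith [norm_nonneg (q₀ - θ₀), norm_nonneg θ₀]
      filter_upwards [hqω.eventually_norm_sub_le_prod (σ := fun s => i (s / m ^ δ) ω) hm hm1 hT
        hdiff hconv hlip hx hσ.1 hσ.2 hxR hq0S hp0S hRS] with n hn t ht
      refine (norm_sub_le_norm_sub_add_norm_sub (q t ω) (x (i (t / m ^ δ) ω)) (θ t ω)).trans ?_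
      have h1 := hn t ht
      set Q := ∏ k ∈ Finset.range (n + 1), if i (k * (T / (n + 1 : ℕ)) / m ^ δ) ω =
        i ((k + 1 : ℕ) * (T / (n + 1 : ℕ)) / m ^ δ) ω then 1 else 16 * (L : ℝ) + 12
      have hQ1 : 1 ≤ Q := Finset.prod_induction _ (1 ≤ ·)
        (fun _ _ => one_le_mul_of_one_le_of_one_le) le_rfl fun k _ => by
          split_ifs <;> linarith
      have h2 : ‖x (i (t / m ^ δ) ω) - θ t ω‖ ≤ S := by
        have e1 := norm_sub_le_norm_sub_add_norm_sub (x (i (t / m ^ δ) ω)) θ₀ (θ t ω)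
        have e2 := norm_sub_le (x (i (t / m ^ δ) ω)) θ₀
        have e3 := hAω t ht
        have e4 : 0 ≤ m * ‖p₀‖ := by positivity
        rw [norm_sub_rev] at e3
        linarith [hxR (i (t / m ^ δ) ω), norm_nonneg (q₀ - θ₀)]
      linarith [mul_le_mul_of_nonneg_left hQ1 hS0])
    refine hprod.trans (ENNReal.ofReal_le_ofReal (le_trans ?_ (mul_exp_le_sgmpErrorBound
      (c := 4 * L + 9) (H := H) (by positivity) (norm_nonneg _) (norm_nonneg _) hm.le ?_
      (by linarith) ?_)))
    · refine mul_le_mul_of_nonneg_left (Real.exp_le_exp.2 ?_) (by positivity)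
      rw [Real.rpow_sub hm, Real.rpow_one]
      calc (16 * (L : ℝ) + 12 - 1) * N * γ * (T / m ^ δ)
          = (16 * L + 11) * (N * γ * (T / m ^ δ)) := by ring
        _ ≤ (m * (1 + T)) * (N * γ * (T / m ^ δ)) :=
            mul_le_mul_of_nonneg_right hcase (by positivity)
        _ = m / m ^ δ * T * (1 + T) * γ * N := by ring
    · have h1 : 4 * (L : ℝ) + 9 ≤ C := by
        have : 0 ≤ (1 + L) * (2 * L * e + 1) := by positivity
        linarith
      have h2 : 1 ≤ m * (1 + T) := by linarith
      rw [mul_assoc]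
      exact h1.trans (le_mul_of_one_le_right hC.le h2)
    · have : 0 ≤ L * B + G := by positivity
      linarith
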